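/- **Setting.** Let $A\in\mathbb R^{n\times n}$, $B\in\mathbb R^{n\times m}$, $C\in\mathbb R^{p\times n}$ with $(A,B)$ stabilizable and $(A,C)$ observable, and consider the plant $x(k+1)=Ax(k)+Bu(k)$, $y(k)=Cx(k)$. Let $L\in\mathbb R^{n\times p}$ be an observer gain such that all eigenvalues of $A_L=A-LC$ lie strictly inside the unit circle, let $\Lambda(z)=\det(zI-A_L)$, let $\mathcal A$ be the companion matrix of $\Lambda$ (ones above the diagonal, last row $-\alpha_0,\dots,-\alpha_{n-1}$ formed from the coefficients of $\Lambda$), $b=(0,\dots,0,1)^{T}\in\mathbb R^n$, and let $\mathcal A_\varepsilon\in\mathbb R^{n\times n}$ be any matrix with characteristic polynomial $\Lambda$. The internal model has the state $\eta=\mathrm{col}(\eta_u^1,\dots,\eta_u^m,\eta_y^1,\dots,\eta_y^p,\eta_\varepsilon)\in\mathbb R^{n_z}$, $n_z=n(m+p+1)$, and the dynamics $$\eta(k+1)=\mathcal G_1\eta(k)+\mathcal G_2\,\mathrm{col}(u(k),y(k),0),\quad \mathcal G_1=\mathrm{block\,diag}[\mathcal A,\dots,\mathcal A,\mathcal A_\varepsilon],\quad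 \mathcal G_2=\mathrm{block\,diag}[b,\dots,b,0].$$ For $F\in\mathbb R^{n\times n}$ and $v\in\mathbb R^n$ let $N(F,v)=[a_0,\dots,a_{n-1}]\in\mathbb R^{n\times n}$, where $\mathrm{adj}(zI-F)v=\sum_{l<n}a_lz^l$. Put $M_u^i=N(A_L,B_i)$ and $M_y^j=N(A_L,L_j)$ ($B_i$, $L_j$ being columns), $\varepsilon_x(0)=x(0)-\sum_iM_u^i\eta_u^i(0)-\sum_jM_y^j\eta_y^j(0)$ (which is $x(0)$ if $\eta_u(0)=0$ and $\eta_y(0)=0$), suppose that $N(\mathcal A_\varepsilon,\eta_\varepsilon(0))$ is nonsingular, and let $$M=[M_u^1,\dots,M_u^m,M_y^1,\dots,M_y^p,\;N(A_L,\varepsilon_x(0))\,N(\mathcal A_\varepsilon,\eta_\varepsilon(0))^{-1}]\in\mathbb R^{n\times n_z}.$$ **Value iteration.** Let $Q_y\in\mathbb R^{p\times p}$ be symmetric positive semidefinite, let $R\in\mathbb R^{m\times m}$ and $Q_\epsilon\in\mathbb R^{n_z\times n_z}$ be symmetric positive definite, and let $\mathcal P_0\in\mathbb R^{n_z\times n_z}$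 be symmetric positive semidefinite. Data $(u(k),y(k),\eta(k))$ are collected along a trajectory of the plant and the internal model under an arbitrary input sequence $u$. For a vector $v$ let $\delta_v$ be the row vector with $\delta_v\,\mathrm{vech}(S)=v^TSv$ for all symmetric $S$ (that is, $\delta_v=\mathrm{vech}(2vv^T-\mathrm{dia}(v)^2)^T$), and let $\delta_{v,w}=(w\otimes v)^T$. Let $\Pi(k_N)$ be the matrix with rows $[\delta_{\eta(k)},\,2\delta_{\eta(k),u(k)},\,\delta_{u(k)}]$, $\Psi(k_N)$ the matrix with rows $\delta_{\eta(k+1)}$, and $\mathcal L(k_N)$ the column with the entries $\eta(k)^TQ_\epsilon\eta(k)+y(k)^TQ_yy(k)+u(k)^TRu(k)$, for $k=0,\dots,k_N$. The model-free value iteration with this modified cost computes, for $j=0,1,2,\dots$, matrices $\mathcal P_{\eta,\eta}^{(j)}$ (symmetric), $\mathcal P_{\eta,u}^{(j)}$, $\mathcal P_{u,u}^{(j)}$ (symmetric) from $$\Pi(k_N)\,\mathrm{col}\big(\mathrm{vech}(\mathcal P_{\eta,\eta}^{(j)}),\mathrm{vec}(\mathcal P_{\eta,u}^{(j)}),\mathrm{vech}(\mathcal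 P_{u,u}^{(j)})\big)=\Psi(k_N)\,\mathrm{vech}(\mathcal P_j)+\mathcal L(k_N)$$ and sets $$\mathcal P_{j+1}=\mathcal P_{\eta,\eta}^{(j)}-\mathcal P_{\eta,u}^{(j)}(\mathcal P_{u,u}^{(j)})^{-1}(\mathcal P_{\eta,u}^{(j)})^T,\qquad \mathcal K_j=(\mathcal P_{u,u}^{(j)})^{-1}(\mathcal P_{\eta,u}^{(j)})^T .$$ **Theorem.** Suppose that $\operatorname{rank}\Pi(k_N)=\tfrac12(n_z+m)(n_z+m+1)$ and $\operatorname{rank}M=n$. Then the value iteration can be carried out, and for every run of it there is an iteration $j$ such that the closed loop of the plant and the internal model under the dynamic output feedback control $u(k)=-\mathcal K_j\eta(k)$, that is, $$x(k+1)=Ax(k)-B\mathcal K_j\eta(k),\qquad \eta(k+1)=\mathcal G_1\eta(k)+\mathcal G_2\,\mathrm{col}(-\mathcal K_j\eta(k),Cx(k),0),$$ is asymptotically stable (the origin $(x,\eta)=(0,0)$ is Lyapunov stable and every trajectory converges to it). -/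

import Mathlib

open Matrix Filter Topology
open scoped Kronecker

namespace OutputFeedbackVI

noncomputable section

/-! ### Discrete-time linear systems -/

/-- All complex eigenvalues of the real matrix `F` lie strictly inside the unit circle. -/
def IsSchur {n : ℕ} (F : Matrix (Fin n) (Fin n) ℝ) : Prop :=
  ∀ z ∈ spectrum ℂ (F.map (algebraMap ℝ ℂ)), ‖z‖ < 1

/-- The pair `(A, B)` is stabilizable. -/
def Stabilizable {n m : ℕ} (A : Matrix (Fin n) (Fin n) ℝ) (B : Matrix (Fin n) (Fin m) ℝ) : Prop :=
  ∃ K : Matrix (Fin m) (Fin n) ℝ, IsSchur (A - B * K)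

/-- The pair `(A, C)` is observable: the observability matrix `col(C, CA, …, CA^(n-1))` has
trivial kernel. -/
def Observable {n p : ℕ} (A : Matrix (Fin n) (Fin n) ℝ) (C : Matrix (Fin p) (Fin n) ℝ) : Prop :=
  ∀ v : Fin n → ℝ, (∀ k < n, (C * A ^ k) *ᵥ v = 0) → v = 0

/-- The origin is a (globally) asymptotically stable equilibrium of `z(k+1) = f (z(k))`:
it is Lyapunov stable and every trajectory converges to it. -/
def AsymptoticallyStable {E : Type*} [NormedAddCommGroup E] (f : E → E) : Prop :=
  (∀ ε > 0, ∃ δ > 0, ∀ z : E, ‖z‖ < δ → ∀ k : ℕ, ‖f^[k] z‖ < ε) ∧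
    ∀ z : E, Tendsto (fun k : ℕ => f^[k] z) atTop (𝓝 0)

/-! ### The internal model -/

/-- Index set of the internal state `η = col(η_u^1, …, η_u^m, η_y^1, …, η_y^p, η_ε)`; it has
`n_z = n (m + p + 1)` elements. The pair `(c, i)` is the `i`-th entry of the block driven by the
channel `c`, a channel being an input or an output of the plant. -/
abbrev EtaIdx (n m p : ℕ) : Type := ((Fin m ⊕ Fin p) × Fin n) ⊕ Fin n

/-- Index set of `ζ = col(u, y, 0)`. -/
abbrev ZetaIdx (m p : ℕ) : Type := (Fin m ⊕ Fin p) ⊕ Unit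

/-- The companion matrix (last row `-α_0, …, -α_{n-1}`, ones above the diagonal) of the
characteristic polynomial `z^n + α_{n-1} z^{n-1} + ⋯ + α_0` of `F`. -/
def companionOf {n : ℕ} (F : Matrix (Fin n) (Fin n) ℝ) : Matrix (Fin n) (Fin n) ℝ :=
  Matrix.of fun i j =>
    if (i : ℕ) + 1 = n then -F.charpoly.coeff j else if (j : ℕ) = i + 1 then 1 else 0

/-- The vector `b = col(0, …, 0, 1)`. -/
def lastVec (n : ℕ) : Fin n → ℝ := fun i => if (i : ℕ) + 1 = n then 1 else 0

/-- `𝒢₁ = block diag [𝒜, …, 𝒜, 𝒜_ε]`, with `𝒜` the companion matrix of the characteristic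
polynomial of the observer matrix `AL`. -/
def G1 {n : ℕ} (m p : ℕ) (AL Aε : Matrix (Fin n) (Fin n) ℝ) :
    Matrix (EtaIdx n m p) (EtaIdx n m p) ℝ :=
  Matrix.fromBlocks ((1 : Matrix (Fin m ⊕ Fin p) (Fin m ⊕ Fin p) ℝ) ⊗ₖ companionOf AL) 0 0 Aε

/-- `𝒢₂ = block diag [b, …, b, 0]`. -/
def G2 (n m p : ℕ) : Matrix (EtaIdx n m p) (ZetaIdx m p) ℝ :=
  Matrix.fromBlocks (Matrix.of fun ci c => if ci.1 = c then lastVec n ci.2 else 0) 0 0 0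

/-- `ζ = col(u, y, 0)`. -/
def zeta {m p : ℕ} (u : Fin m → ℝ) (y : Fin p → ℝ) : ZetaIdx m p → ℝ :=
  Sum.elim (Sum.elim u y) 0

/-! ### The parameterization matrix -/

/-- The matrix `[a_0, a_1, …, a_{n-1}]` of the coefficients of the polynomial vector
`adj(z I - F) v = a_0 + a_1 z + ⋯ + a_{n-1} z^{n-1}`. -/
def adjCoeff {n : ℕ} (F : Matrix (Fin n) (Fin n) ℝ) (v : Fin n → ℝ) : Matrix (Fin n) (Fin n) ℝ :=
  Matrix.of fun i l =>
    ((F.charmatrix.adjugate *ᵥ fun r => Polynomial.C (v r)) i).coeff (l : ℕ)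

/-- `[M_u^1, …, M_u^m, M_y^1, …, M_y^p]`: the block of a channel consists of the coefficients of
`adj(z I - AL) w`, with `w` the column of `[B, L]` that belongs to the channel. -/
def Mobs {n m p : ℕ} (AL : Matrix (Fin n) (Fin n) ℝ) (B : Matrix (Fin n) (Fin m) ℝ)
    (L : Matrix (Fin n) (Fin p) ℝ) : Matrix (Fin n) ((Fin m ⊕ Fin p) × Fin n) ℝ :=
  Matrix.of fun i cl => adjCoeff AL (fun r => Matrix.fromCols B L r cl.1) i cl.2

/-- The initial observer error `ε_x(0) = x(0) - x̂(0)`, where the observer state is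
`x̂ = ∑ M_u^i η_u^i + ∑ M_y^j η_y^j`; it is `x(0)` if `η_u(0)` and `η_y(0)` vanish. -/
def errorInit {n m p : ℕ} (AL : Matrix (Fin n) (Fin n) ℝ) (B : Matrix (Fin n) (Fin m) ℝ)
    (L : Matrix (Fin n) (Fin p) ℝ) (x0 : Fin n → ℝ) (η0 : EtaIdx n m p → ℝ) : Fin n → ℝ :=
  x0 - Mobs AL B L *ᵥ (η0 ∘ Sum.inl)

/-- `M = [M_u^1, …, M_u^m, M_y^1, …, M_y^p, M_{ε_x} M_{η_ε}⁻¹]`. -/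
def paramMatrix {n m p : ℕ} (AL Aε : Matrix (Fin n) (Fin n) ℝ) (B : Matrix (Fin n) (Fin m) ℝ)
    (L : Matrix (Fin n) (Fin p) ℝ) (x0 : Fin n → ℝ) (η0 : EtaIdx n m p → ℝ) :
    Matrix (Fin n) (EtaIdx n m p) ℝ :=
  Matrix.fromCols (Mobs AL B L)
    (adjCoeff AL (errorInit AL B L x0 η0) * (adjCoeff Aε (η0 ∘ Sum.inr))⁻¹)

/-! ### Data and regressors -/

/-- `x, u, y, η` is a trajectory of the plant together with the internal model. -/
structure IsTrajectory {n m p : ℕ} (A : Matrix (Fin n) (Fin n) ℝ) (B : Matrix (Fin n) (Fin m) ℝ)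
    (C : Matrix (Fin p) (Fin n) ℝ) (L : Matrix (Fin n) (Fin p) ℝ) (Aε : Matrix (Fin n) (Fin n) ℝ)
    (x : ℕ → Fin n → ℝ) (u : ℕ → Fin m → ℝ) (y : ℕ → Fin p → ℝ) (η : ℕ → EtaIdx n m p → ℝ) :
    Prop where
  state : ∀ k, x (k + 1) = A *ᵥ x k + B *ᵥ u k
  output : ∀ k, y k = C *ᵥ x k
  internal : ∀ k, η (k + 1) = G1 m p (A - L * C) Aε *ᵥ η k + G2 n m p *ᵥ zeta (u k) (y k)

/-- Half-vectorization of a symmetric matrix, indexed by the unordered pairs `{i, j}`: the entry at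
`{i, j}` is `S i j` (written as `(S i j + S j i) / 2`, so that it is well defined). -/
def vech {ι : Type*} (S : Matrix ι ι ℝ) (s : Sym2 ι) : ℝ :=
  Sym2.lift ⟨fun i j => (S i j + S j i) / 2, fun i j => by simp only [add_comm]⟩ s

/-- `δ_v = vech(2 v vᵀ - dia(v)²)`, so that `δ_v · vech S = vᵀ S v` for symmetric `S`. -/
def delta {ι : Type*} [Fintype ι] [DecidableEq ι] (v : ι → ℝ) : Sym2 ι → ℝ :=
  vech ((2 : ℝ) • Matrix.vecMulVec v v - Matrix.diagonal v ^ 2)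

/-- `δ_{v,w} = w ⊗ v`, so that `δ_{v,w} · vec Y = vᵀ Y w`. -/
def deltaCross {ι κ : Type*} (v : ι → ℝ) (w : κ → ℝ) : κ × ι → ℝ := fun q => w q.1 * v q.2

/-- Index set of the unknowns `col(vech 𝒫_ηη, vec 𝒫_ηu, vech 𝒫_uu)`; it has
`(n_z + m) (n_z + m + 1) / 2` elements. -/
abbrev ThetaIdx (n m p : ℕ) : Type :=
  Sym2 (EtaIdx n m p) ⊕ (Fin m × EtaIdx n m p) ⊕ Sym2 (Fin m)

/-- The data matrix `Π(k_N)` with rows `φ(k) = [δ_η(k), 2 δ_{η,u}(k), δ_u(k)]`, `k = 0, …, k_N`. -/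
def dataPi {n m p : ℕ} (kN : ℕ) (η : ℕ → EtaIdx n m p → ℝ) (u : ℕ → Fin m → ℝ) :
    Matrix (Fin (kN + 1)) (ThetaIdx n m p) ℝ :=
  Matrix.of fun k =>
    Sum.elim (delta (η k)) (Sum.elim ((2 : ℝ) • deltaCross (η k) (u k)) (delta (u k)))

/-- The data matrix `Ψ(k_N)` with rows `ψ(k) = δ_η(k + 1)`, `k = 0, …, k_N`. -/
def dataPsi {n m p : ℕ} (kN : ℕ) (η : ℕ → EtaIdx n m p → ℝ) :
    Matrix (Fin (kN + 1)) (Sym2 (EtaIdx n m p)) ℝ :=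
  Matrix.of fun k => delta (η (k + 1))

/-- The modified utility function `ηᵀ Q_ε η + yᵀ Q_y y + uᵀ R u`. -/
def utility {n m p : ℕ} (Qε : Matrix (EtaIdx n m p) (EtaIdx n m p) ℝ)
    (Qy : Matrix (Fin p) (Fin p) ℝ) (R : Matrix (Fin m) (Fin m) ℝ)
    (η : EtaIdx n m p → ℝ) (y : Fin p → ℝ) (u : Fin m → ℝ) : ℝ :=
  η ⬝ᵥ Qε *ᵥ η + y ⬝ᵥ Qy *ᵥ y + u ⬝ᵥ R *ᵥ u

/-! ### The model-free value iteration -/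

/-- The matrices that the value iteration produces, one of each kind for every iteration. -/
structure VISequence (n m p : ℕ) where
  P : ℕ → Matrix (EtaIdx n m p) (EtaIdx n m p) ℝ
  Pηη : ℕ → Matrix (EtaIdx n m p) (EtaIdx n m p) ℝ
  Pηu : ℕ → Matrix (EtaIdx n m p) (Fin m) ℝ
  Puu : ℕ → Matrix (Fin m) (Fin m) ℝ

/-- The gain `𝒦_j = (𝒫_uu^(j))⁻¹ (𝒫_ηu^(j))ᵀ`. -/
def VISequence.gain {n m p : ℕ} (S : VISequence n m p) (j : ℕ) : Matrix (Fin m) (EtaIdx n m p) ℝ :=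
  (S.Puu j)⁻¹ * (S.Pηu j)ᵀ

/-- `S` is a run of the model-free value iteration with the modified utility function from the
initial matrix `P0`, on the data `η, y, u` collected for `k = 0, …, k_N`. -/
structure IsVIRun {n m p : ℕ} (Qε : Matrix (EtaIdx n m p) (EtaIdx n m p) ℝ)
    (Qy : Matrix (Fin p) (Fin p) ℝ) (R : Matrix (Fin m) (Fin m) ℝ)
    (P0 : Matrix (EtaIdx n m p) (EtaIdx n m p) ℝ) (kN : ℕ)
    (η : ℕ → EtaIdx n m p → ℝ) (y : ℕ → Fin p → ℝ) (u : ℕ → Fin m → ℝ)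
    (S : VISequence n m p) : Prop where
  init : S.P 0 = P0
  symm_ηη : ∀ j, (S.Pηη j).IsSymm
  symm_uu : ∀ j, (S.Puu j).IsSymm
  learning : ∀ j,
    dataPi kN η u *ᵥ Sum.elim (vech (S.Pηη j)) (Sum.elim (S.Pηu j).vec (vech (S.Puu j))) =
      dataPsi kN η *ᵥ vech (S.P j) + fun k : Fin (kN + 1) => utility Qε Qy R (η k) (y k) (u k)
  update : ∀ j, S.P (j + 1) = S.Pηη j - S.Pηu j * (S.Puu j)⁻¹ * (S.Pηu j)ᵀ

/-! ### The closed loop -/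

/-- One step of the closed loop of the plant `x(k+1) = A x(k) + B u(k)`, `y(k) = C x(k)` with the
dynamic output feedback controller `u(k) = -𝒦 η(k)`, `η(k+1) = 𝒢₁ η(k) + 𝒢₂ ζ(k)`. -/
def closedLoop {n m p : ℕ} (A : Matrix (Fin n) (Fin n) ℝ) (B : Matrix (Fin n) (Fin m) ℝ)
    (C : Matrix (Fin p) (Fin n) ℝ) (L : Matrix (Fin n) (Fin p) ℝ) (Aε : Matrix (Fin n) (Fin n) ℝ)
    (K : Matrix (Fin m) (EtaIdx n m p) ℝ) (s : (Fin n → ℝ) × (EtaIdx n m p → ℝ)) :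
    (Fin n → ℝ) × (EtaIdx n m p → ℝ) :=
  (A *ᵥ s.1 + B *ᵥ (-(K *ᵥ s.2)),
    G1 m p (A - L * C) Aε *ᵥ s.2 + G2 n m p *ᵥ zeta (-(K *ᵥ s.2)) (C *ᵥ s.1))

end

end OutputFeedbackVI

open OutputFeedbackVI

/-!
The proof shows that the data-driven iteration is Riccati value iteration for a stabilizable linear
system with state `η`, that some gain of this iteration stabilizes that system, and that the plant
follows by a separation argument.

Since `(z I - F) adj(z I - F) v = Λ(z) v`, the coefficient matrix `N(F, v)` satisfies
`F N = N 𝒜` and `N b = v` (`mul_adjCoeff`, `adjCoeff_mulVec_lastVec`). Hence the matrix `M` satisfies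
`M 𝒢₁ = A_L M` and `M 𝒢₂ = [B, L, 0]`, and `x(k) = M η(k)` holds along the data
(`state_eq_mulVec`). So `η(k+1) = F η(k) + G u(k)` with `F = 𝒢₁ + 𝒢₂ col(0, C M, 0)` and
`G = 𝒢₂ col(I, 0, 0)`, where `M F = A M` and `M G = B`. If `A - B K` is stable, then so is `F - G K M`:
its eigenvectors are mapped by `M` to eigenvectors of `A - B K` or are eigenvectors of the stable
matrix `𝒢₁` (`exists_schurStable_reduced`).

The learning equation is the Bellman equation of this system, with the stage cost
`Q = Q_ε + (C M)ᵀ Q_y C M`, and the rank condition makes its solution unique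
(`dataPi_mulVec_riccati`, `eq_riccati_of_learning`). The value functions
`V_j(v) = vᵀ P_j v` are bounded by `c Q`, because a stabilizing feedback exists. From
`V_{j+1} ≤ (1 + a) V_j` dynamic programming gives `V_{j+2} ≤ (1 + a) V_{j+1} - a Q`, which is at most
`(1 + a (1 - 1/c)) V_{j+1}`; so `V_{j+1} - V_j ≤ Q / 2` for some `j`, without any monotonicity of
the iteration (`exists_valueFunction_succ_le`). For this `j`, the function `V_j` strictly decreases
along `F - G K_j`, which is therefore stable (`exists_schurStable_of_valueIteration`).

In the closed loop the error `x - M η` evolves with the stable matrix `A_L`, and where it vanishes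
`η` evolves with `F - G K_j`; so the closed loop is stable (`asymptoticallyStable_closedLoop`).
-/

/-! ### Schur stability of real matrices -/

/-- `IsSchur` for an arbitrary finite index type: all complex eigenvalues of `F` lie strictly inside
the unit circle. -/
def SchurStable {ι : Type*} [Fintype ι] [DecidableEq ι] (F : Matrix ι ι ℝ) : Prop :=
  ∀ z ∈ spectrum ℂ (F.map (algebraMap ℝ ℂ)), ‖z‖ < 1

theorem mem_spectrum_iff_exists_mulVec {ι K : Type*} [Fintype ι] [DecidableEq ι] [Field K]
    (F : Matrix ι ι K) (z : K) : z ∈ spectrum K F ↔ ∃ v ≠ 0, F *ᵥ v = z • v := by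
  rw [← Matrix.spectrum_toLin', ← Module.End.hasEigenvalue_iff_mem_spectrum]
  constructor
  · intro h
    obtain ⟨v, hv⟩ := h.exists_hasEigenvector
    exact ⟨v, hv.2, by simpa using hv.apply_eq_smul⟩
  · rintro ⟨v, hv, h⟩
    exact Module.End.hasEigenvalue_of_hasEigenvector
      (x := v) ⟨Module.End.mem_eigenspace_iff.2 (by simpa using h), hv⟩

namespace SchurStable

variable {ι κ : Type*} [Fintype ι] [DecidableEq ι] [Fintype κ] [DecidableEq κ]

theorem norm_lt_one {F : Matrix ι ι ℝ} (hF : SchurStable F) {v : ι → ℂ} (hv : v ≠ 0) {z : ℂ}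
    (h : F.map (algebraMap ℝ ℂ) *ᵥ v = z • v) : ‖z‖ < 1 :=
  hF z ((mem_spectrum_iff_exists_mulVec _ _).2 ⟨v, hv, h⟩)

theorem of_eigenvector {F : Matrix ι ι ℝ}
    (h : ∀ (v : ι → ℂ) (z : ℂ), v ≠ 0 → F.map (algebraMap ℝ ℂ) *ᵥ v = z • v → ‖z‖ < 1) :
    SchurStable F := by
  intro z hz
  obtain ⟨v, hv, hz⟩ := (mem_spectrum_iff_exists_mulVec _ _).1 hz
  exact h v z hv hz

theorem zero : SchurStable (0 : Matrix ι ι ℝ) := by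
  refine of_eigenvector fun v z hv h => ?_
  have h0 : z • v = 0 := by rw [← h]; ext i; simp [mulVec, dotProduct]
  rcases smul_eq_zero.1 h0 with h0 | h0
  · simp [h0]
  · exact absurd h0 hv

/-- Stability of a cascade: if `M` intertwines `G + H * M` with a stable matrix `A`, then an
eigenvector of `G + H * M` is mapped by `M` to an eigenvector of `A`, or is killed by `M` and is then
an eigenvector of `G`. -/
theorem add_mul {G : Matrix ι ι ℝ} {H : Matrix ι κ ℝ} {M : Matrix κ ι ℝ} {A : Matrix κ κ ℝ}
    (hG : SchurStable G) (hA : SchurStable A) (h : M * (G + H * M) = A * M) :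
    SchurStable (G + H * M) := by
  refine of_eigenvector fun v z hv hz => ?_
  have hc := congrArg (fun X => X.map (algebraMap ℝ ℂ)) h
  simp only [Matrix.map_mul] at hc
  by_cases hMv : M.map (algebraMap ℝ ℂ) *ᵥ v = 0
  · refine hG.norm_lt_one hv ?_
    rw [← hz, Matrix.map_add _ (by simp), Matrix.map_mul, Matrix.add_mulVec, ← mulVec_mulVec, hMv,
      mulVec_zero, add_zero]
  · refine hA.norm_lt_one hMv ?_
    rw [mulVec_mulVec, ← hc, ← mulVec_mulVec, hz, mulVec_smul]

/-- Stein's criterion: a nonnegative quadratic form that strictly decreases along `F` certifies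
stability. For a complex eigenvector `a + i b` with eigenvalue `z`, the sum of the values of the form
at `a` and at `b` is multiplied by `‖z‖²`. -/
theorem of_quadratic_decrease {F P : Matrix ι ι ℝ} (hP : ∀ v : ι → ℝ, 0 ≤ v ⬝ᵥ P *ᵥ v)
    (h : ∀ v : ι → ℝ, v ≠ 0 → (F *ᵥ v) ⬝ᵥ P *ᵥ (F *ᵥ v) < v ⬝ᵥ P *ᵥ v) : SchurStable F := by
  refine of_eigenvector fun v z hv hz => ?_
  set a : ι → ℝ := fun i => (v i).re with ha
  set b : ι → ℝ := fun i => (v i).im with hb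
  have hFa : F *ᵥ a = z.re • a - z.im • b := by
    ext i
    have := congrArg Complex.re (congrFun hz i)
    simpa [mulVec, dotProduct, a, b] using this
  have hFb : F *ᵥ b = z.re • b + z.im • a := by
    ext i
    have := congrArg Complex.im (congrFun hz i)
    simpa [mulVec, dotProduct, a, b] using this
  have hle : ∀ w : ι → ℝ, (F *ᵥ w) ⬝ᵥ P *ᵥ (F *ᵥ w) ≤ w ⬝ᵥ P *ᵥ w := by
    intro w
    by_cases hw : w = 0
    · simp [hw]
    · exact (h w hw).le
  have hlt : (F *ᵥ a) ⬝ᵥ P *ᵥ (F *ᵥ a) + (F *ᵥ b) ⬝ᵥ P *ᵥ (F *ᵥ b) <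
      a ⬝ᵥ P *ᵥ a + b ⬝ᵥ P *ᵥ b := by
    by_cases ha0 : a = 0
    · have hb0 : b ≠ 0 := by
        rintro hb0
        apply hv
        ext i
        exact Complex.ext (congrFun ha0 i) (congrFun hb0 i)
      exact add_lt_add_of_le_of_lt (hle a) (h b hb0)
    · exact add_lt_add_of_lt_of_le (h a ha0) (hle b)
  have hsum : (F *ᵥ a) ⬝ᵥ P *ᵥ (F *ᵥ a) + (F *ᵥ b) ⬝ᵥ P *ᵥ (F *ᵥ b) =
      (z.re ^ 2 + z.im ^ 2) * (a ⬝ᵥ P *ᵥ a + b ⬝ᵥ P *ᵥ b) := by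
    rw [hFa, hFb]
    simp only [mulVec_sub, mulVec_add, mulVec_smul, dotProduct_sub, dotProduct_add, sub_dotProduct,
      add_dotProduct, smul_dotProduct, dotProduct_smul, smul_eq_mul]
    ring
  have hz2 : ‖z‖ ^ 2 = z.re ^ 2 + z.im ^ 2 := by
    rw [Complex.sq_norm, Complex.normSq_apply]; ring
  rw [hsum, ← hz2] at hlt
  by_contra! hge
  have := hP a
  have := hP b
  nlinarith [mul_self_nonneg (‖z‖ - 1)]

open scoped Matrix.Norms.Operator in
/-- By Gelfand's formula, the powers of a stable matrix decay geometrically. -/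
theorem exists_pow_bound {F : Matrix ι ι ℝ} (hF : SchurStable F) :
    ∃ c r : ℝ, 0 ≤ c ∧ 0 ≤ r ∧ r < 1 ∧ ∀ (k : ℕ) (v : ι → ℝ), ‖F ^ k *ᵥ v‖ ≤ c * r ^ k * ‖v‖ := by
  cases isEmpty_or_nonempty ι
  · exact ⟨0, 0, le_rfl, le_rfl, one_pos, fun k v => by simp [Subsingleton.elim (F ^ k *ᵥ v) 0]⟩
  set Fc := F.map (algebraMap ℝ ℂ) with hFc
  have hrad : spectralRadius ℂ Fc < ((1 : NNReal) : ENNReal) :=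
    spectrum.spectralRadius_lt_of_forall_lt Fc fun z hz => by
      rw [← NNReal.coe_lt_coe]; simpa using hF z hz
  obtain ⟨r, hr1, hr2⟩ := ENNReal.lt_iff_exists_nnreal_btwn.1 hrad
  have hr0 : 0 < r := by
    rw [← ENNReal.coe_lt_coe]; exact lt_of_le_of_lt bot_le hr1
  have hr2' : r < 1 := by exact_mod_cast hr2
  have hev : ∀ᶠ k : ℕ in atTop, ‖Fc ^ k‖ ≤ (r : ℝ) ^ k := by
    filter_upwards [(spectrum.pow_nnnorm_pow_one_div_tendsto_nhds_spectralRadius Fc).eventually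
      (gt_mem_nhds hr1), eventually_ge_atTop 1] with k hk hk1
    have hk0 : (k : ℝ) ≠ 0 := by positivity
    have h2 := ENNReal.rpow_le_rpow hk.le (Nat.cast_nonneg k : (0 : ℝ) ≤ k)
    rw [← ENNReal.rpow_mul, one_div, inv_mul_cancel₀ hk0, ENNReal.rpow_one, ENNReal.rpow_natCast] at h2
    have h3 : ‖Fc ^ k‖₊ ≤ r ^ k := by exact_mod_cast h2
    exact_mod_cast h3
  obtain ⟨N, hN⟩ := eventually_atTop.1 hev
  have hrpos : (0 : ℝ) < r := hr0
  set c : ℝ := 1 + ∑ k ∈ Finset.range N, ‖Fc ^ k‖ / (r : ℝ) ^ k with hc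
  have hsn : ∀ k ∈ Finset.range N, 0 ≤ ‖Fc ^ k‖ / (r : ℝ) ^ k := fun k _ => by positivity
  have hc1 : 1 ≤ c := by
    have := Finset.sum_nonneg hsn
    linarith
  have hbound : ∀ k, ‖Fc ^ k‖ ≤ c * (r : ℝ) ^ k := by
    intro k
    rcases lt_or_ge k N with hk | hk
    · have h1 := Finset.single_le_sum hsn (Finset.mem_range.2 hk)
      rw [← div_le_iff₀ (by positivity)]
      linarith
    · exact (hN k hk).trans (le_mul_of_one_le_left (by positivity) hc1)
  refine ⟨c, r, by linarith, hrpos.le, by exact_mod_cast hr2', fun k v => ?_⟩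
  have hnorm : ∀ w : ι → ℝ, ‖fun i => (w i : ℂ)‖ = ‖w‖ := by
    intro w
    simp [Pi.norm_def, nnnorm]
  have hmap : (fun i => (((F ^ k *ᵥ v) i : ℝ) : ℂ)) = Fc ^ k *ᵥ fun i => (v i : ℂ) := by
    have hp : Fc ^ k = (F ^ k).map (algebraMap ℝ ℂ) :=
      ((algebraMap ℝ ℂ).mapMatrix.map_pow F k).symm
    rw [hp]
    ext i
    exact RingHom.map_mulVec (algebraMap ℝ ℂ) (F ^ k) v i
  rw [← hnorm (F ^ k *ᵥ v), hmap, ← hnorm v]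
  exact (linfty_opNorm_mulVec _ _).trans (mul_le_mul_of_nonneg_right (hbound k) (norm_nonneg _))

end SchurStable

/-! ### Adjugate coefficients and the internal model -/

/-- `adj(z I - F) v` as a vector of polynomials. -/
noncomputable def adjPoly {n : ℕ} (F : Matrix (Fin n) (Fin n) ℝ) (v : Fin n → ℝ) :
    Fin n → Polynomial ℝ :=
  F.charmatrix.adjugate *ᵥ fun r => Polynomial.C (v r)

section Adjugate

variable {n : ℕ} (F : Matrix (Fin n) (Fin n) ℝ) (v : Fin n → ℝ)

theorem charmatrix_mulVec_adjPoly (i : Fin n) :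
    Polynomial.X * adjPoly F v i - ∑ j, Polynomial.C (F i j) * adjPoly F v j =
      F.charpoly * Polynomial.C (v i) := by
  have h : F.charmatrix *ᵥ adjPoly F v = F.charpoly • fun r => Polynomial.C (v r) := by
    rw [adjPoly, mulVec_mulVec, mul_adjugate, smul_mulVec, one_mulVec, charpoly]
  have h' := congrFun h i
  rw [charmatrix, sub_mulVec] at h'
  simpa [mulVec, dotProduct, Matrix.scalar_apply, Matrix.diagonal_apply] using h'

theorem adjPoly_coeff_succ (i : Fin n) (l : ℕ) :
    (adjPoly F v i).coeff l - ∑ j, F i j * (adjPoly F v j).coeff (l + 1) =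
      F.charpoly.coeff (l + 1) * v i := by
  have := congrArg (fun q => Polynomial.coeff q (l + 1)) (charmatrix_mulVec_adjPoly F v i)
  simpa [Polynomial.finsetSum_coeff] using this

theorem adjPoly_coeff_zero (i : Fin n) :
    -∑ j, F i j * (adjPoly F v j).coeff 0 = F.charpoly.coeff 0 * v i := by
  have := congrArg (fun q => Polynomial.coeff q 0) (charmatrix_mulVec_adjPoly F v i)
  simpa [Polynomial.finsetSum_coeff] using this

/-- The entries of `adj(z I - F) v` have degree less than `n`: by descending induction, since the
right-hand side of `(z I - F) adj(z I - F) v = Λ(z) v` has degree at most `n`. -/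
theorem adjPoly_coeff_eq_zero (i : Fin n) {l : ℕ} (hl : n ≤ l) : (adjPoly F v i).coeff l = 0 := by
  obtain ⟨N, hN⟩ : ∃ N : ℕ, ∀ j, (adjPoly F v j).natDegree < N :=
    ⟨(∑ j, (adjPoly F v j).natDegree) + 1, fun j => Nat.lt_succ_of_le
      (Finset.single_le_sum (f := fun j => (adjPoly F v j).natDegree) (fun _ _ => Nat.zero_le _)
        (Finset.mem_univ j))⟩
  have key : ∀ d l, n ≤ l → N ≤ l + d → ∀ j, (adjPoly F v j).coeff l = 0 := by
    intro d
    induction d with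
    | zero =>
      intro l _ h j
      exact Polynomial.coeff_eq_zero_of_natDegree_lt ((hN j).trans_le h)
    | succ d ih =>
      intro l hl h j
      have h1 := adjPoly_coeff_succ F v j l
      have h2 : F.charpoly.coeff (l + 1) = 0 := by
        refine Polynomial.coeff_eq_zero_of_natDegree_lt ?_
        rw [charpoly_natDegree_eq_dim, Fintype.card_fin]
        omega
      rw [h2, Finset.sum_eq_zero fun k _ => by rw [ih (l + 1) (by omega) (by omega) k, mul_zero]] at h1
      simpa using h1
  exact key N l hl (by omega) i

theorem adjPoly_coeff_last (i : Fin n) {l : ℕ} (hl : l + 1 = n) :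
    (adjPoly F v i).coeff l = v i := by
  have h1 := adjPoly_coeff_succ F v i l
  have h2 : F.charpoly.coeff (l + 1) = 1 := by
    have := F.charpoly_monic.coeff_natDegree
    rwa [charpoly_natDegree_eq_dim, Fintype.card_fin, congrArg F.charpoly.coeff hl.symm] at this
  rw [h2, Finset.sum_eq_zero fun k _ => by rw [adjPoly_coeff_eq_zero F v k (by omega), mul_zero]] at h1
  simpa using h1

theorem adjCoeff_mulVec_lastVec : adjCoeff F v *ᵥ lastVec n = v := by
  ext i
  have hn : 0 < n := i.pos
  rw [mulVec, dotProduct, Finset.sum_eq_single ⟨n - 1, by omega⟩]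
  · have h1 : n - 1 + 1 = n := by omega
    have := adjPoly_coeff_last F v i h1
    simpa [adjCoeff, lastVec, h1, adjPoly] using this
  · intro b _ hb
    have : (b : ℕ) + 1 ≠ n := fun h => hb (Fin.ext (by simp; omega))
    simp [lastVec, this]
  · simp

/-- The coefficient matrix of `adj(z I - F) v` intertwines the companion matrix with `F`. -/
theorem mul_adjCoeff : F * adjCoeff F v = adjCoeff F v * companionOf F := by
  ext i l
  have hn : 0 < n := i.pos
  have hl := l.2
  have hF : (F * adjCoeff F v) i l = ∑ j, F i j * (adjPoly F v j).coeff l := rfl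
  have hlast : (adjPoly F v i).coeff (n - 1) = v i := adjPoly_coeff_last F v i (by omega)
  have hR : (adjCoeff F v * companionOf F) i l =
      ∑ k : Fin n, ((if (k : ℕ) + 1 = n then -(v i * F.charpoly.coeff l) else 0) +
        if (l : ℕ) = k + 1 then (adjPoly F v i).coeff k else 0) := by
    rw [mul_apply]
    refine Finset.sum_congr rfl fun k _ => ?_
    have hk : adjCoeff F v i k = (adjPoly F v i).coeff k := rfl
    rw [hk]
    by_cases h1 : (k : ℕ) + 1 = n
    · have h2 : (l : ℕ) ≠ k + 1 := by omega
      have h3 : (k : ℕ) = n - 1 := by omega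
      rw [if_pos h1, if_neg h2, companionOf, of_apply, if_pos h1]
      rw [h3, hlast]; ring
    · simp only [companionOf, of_apply, h1, if_false, zero_add, mul_ite, mul_one, mul_zero]
  have hs1 : ∑ k : Fin n, (if (k : ℕ) + 1 = n then -(v i * F.charpoly.coeff l) else 0) =
      -(v i * F.charpoly.coeff l) := by
    rw [Finset.sum_eq_single ⟨n - 1, by omega⟩]
    · simp; omega
    · intro b _ hb
      exact if_neg fun h => hb (Fin.ext (by simp; omega))
    · simp
  rw [hF, hR, Finset.sum_add_distrib, hs1]
  rcases Nat.eq_zero_or_pos (l : ℕ) with h0 | h0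
  · rw [Finset.sum_eq_zero fun k _ => if_neg (by omega), h0]
    linarith [adjPoly_coeff_zero F v i]
  · have hs2 : ∑ k : Fin n, (if (l : ℕ) = k + 1 then (adjPoly F v i).coeff k else 0) =
        (adjPoly F v i).coeff (l - 1) := by
      rw [Finset.sum_eq_single ⟨l - 1, by omega⟩]
      · exact if_pos (by simp; omega)
      · intro b _ hb
        exact if_neg fun h => hb (Fin.ext (by simp; omega))
      · simp
    have := adjPoly_coeff_succ F v i (l - 1)
    rw [Nat.sub_add_cancel h0] at this
    rw [hs2]
    linarith

end Adjugate

theorem companionOf_congr {n : ℕ} {F F' : Matrix (Fin n) (Fin n) ℝ}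
    (h : F.charpoly = F'.charpoly) : companionOf F = companionOf F' := by
  simp only [companionOf, h]

theorem SchurStable.of_charpoly_eq {n : ℕ} {F F' : Matrix (Fin n) (Fin n) ℝ} (hF : SchurStable F)
    (h : F'.charpoly = F.charpoly) : SchurStable F' := by
  intro z hz
  refine hF z ?_
  rw [mem_spectrum_iff_isRoot_charpoly] at hz ⊢
  rwa [charpoly_map, ← h, ← charpoly_map]

/-- The companion matrix of a stable matrix `F` is stable, provided that some matrix with the same
characteristic polynomial has a cyclic vector `v`: it is then similar to that matrix. -/
theorem SchurStable.companionOf {n : ℕ} {F F' : Matrix (Fin n) (Fin n) ℝ} {v : Fin n → ℝ}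
    (hF : SchurStable F) (h : F'.charpoly = F.charpoly) (hv : IsUnit (adjCoeff F' v)) :
    SchurStable (companionOf F) := by
  refine of_eigenvector fun w z hw hz => ?_
  have hc := congrArg (fun X => X.map (algebraMap ℝ ℂ)) (mul_adjCoeff F' v)
  simp only [Matrix.map_mul, companionOf_congr h] at hc
  have hu : IsUnit ((adjCoeff F' v).map (algebraMap ℝ ℂ)) :=
    hv.map (algebraMap ℝ ℂ).mapMatrix
  refine (hF.of_charpoly_eq h).norm_lt_one (v := (adjCoeff F' v).map (algebraMap ℝ ℂ) *ᵥ w) ?_ ?_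
  · intro h0
    exact hw (mulVec_injective_of_isUnit hu (h0.trans (mulVec_zero _).symm))
  · rw [mulVec_mulVec, hc, ← mulVec_mulVec, hz, mulVec_smul]

theorem fromBlocks_kronecker_mulVec_inl {ι κ μ α : Type*} [Fintype ι] [DecidableEq ι] [Fintype κ]
    [Fintype μ] [CommRing α] (X : Matrix κ κ α) (Y : Matrix μ μ α) (w : (ι × κ) ⊕ μ → α) (c : ι)
    (i : κ) :
    (fromBlocks ((1 : Matrix ι ι α) ⊗ₖ X) 0 0 Y *ᵥ w) (Sum.inl (c, i)) =
      (X *ᵥ fun j => w (Sum.inl (c, j))) i := by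
  simp only [mulVec, dotProduct, Fintype.sum_sum_type, fromBlocks_apply₁₁, fromBlocks_apply₁₂,
    Matrix.zero_apply, zero_mul, Finset.sum_const_zero, add_zero, Fintype.sum_prod_type,
    kroneckerMap_apply]
  rw [Finset.sum_eq_single c]
  · simp
  · intro b _ hb
    simp [Matrix.one_apply_ne hb.symm]
  · simp

theorem SchurStable.fromBlocks_kronecker {ι κ μ : Type*} [Fintype ι] [DecidableEq ι] [Fintype κ]
    [DecidableEq κ] [Fintype μ] [DecidableEq μ] {X : Matrix κ κ ℝ} {Y : Matrix μ μ ℝ}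
    (hX : SchurStable X) (hY : SchurStable Y) :
    SchurStable (fromBlocks ((1 : Matrix ι ι ℝ) ⊗ₖ X) 0 0 Y) := by
  refine of_eigenvector fun w z hw hz => ?_
  by_cases hr : w ∘ Sum.inr = 0
  · obtain ⟨c, hc⟩ : ∃ c, (fun i => w (Sum.inl (c, i))) ≠ 0 := by
      by_contra! h
      apply hw
      ext (⟨c, i⟩ | i)
      · exact congrFun (h c) i
      · exact congrFun hr i
    refine hX.norm_lt_one hc ?_
    have hmap : (fromBlocks ((1 : Matrix ι ι ℝ) ⊗ₖ X) 0 0 Y).map (algebraMap ℝ ℂ) =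
        fromBlocks ((1 : Matrix ι ι ℂ) ⊗ₖ X.map (algebraMap ℝ ℂ)) 0 0
          (Y.map (algebraMap ℝ ℂ)) := by
      ext (⟨a, b⟩ | a) (⟨c, d⟩ | c) <;> simp [Matrix.one_apply, apply_ite Complex.ofReal]
    ext i
    rw [← fromBlocks_kronecker_mulVec_inl (ι := ι) (X.map (algebraMap ℝ ℂ))
      (Y.map (algebraMap ℝ ℂ)), ← hmap, hz]
    rfl
  · refine hY.norm_lt_one hr ?_
    ext i
    have := congrFun hz (Sum.inr i)
    simpa [mulVec, dotProduct] using this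

/-! ### Convergence of value iteration -/

section Quadratic

variable {ι : Type*} [Fintype ι]

theorem exists_quadratic_le_norm_sq (S : Matrix ι ι ℝ) :
    ∃ c : ℝ, 0 ≤ c ∧ ∀ v : ι → ℝ, v ⬝ᵥ S *ᵥ v ≤ c * ‖v‖ ^ 2 := by
  refine ⟨∑ i, ∑ j, |S i j|, Finset.sum_nonneg fun i _ => Finset.sum_nonneg fun j _ => abs_nonneg _,
    fun v => ?_⟩
  simp only [dotProduct, mulVec, Finset.mul_sum, Finset.sum_mul]
  refine Finset.sum_le_sum fun i _ => Finset.sum_le_sum fun j _ => ?_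
  have hi : |v i| ≤ ‖v‖ := norm_le_pi_norm v i
  have hj : |v j| ≤ ‖v‖ := norm_le_pi_norm v j
  calc v i * (S i j * v j) ≤ |v i * (S i j * v j)| := le_abs_self _
    _ = |S i j| * (|v i| * |v j|) := by rw [abs_mul, abs_mul]; ring
    _ ≤ |S i j| * (‖v‖ * ‖v‖) := by gcongr
    _ = |S i j| * ‖v‖ ^ 2 := by ring

theorem exists_norm_sq_le_quadratic {S : Matrix ι ι ℝ}
    (hS : ∀ v : ι → ℝ, v ≠ 0 → 0 < v ⬝ᵥ S *ᵥ v) :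
    ∃ c : ℝ, 0 < c ∧ ∀ v : ι → ℝ, c * ‖v‖ ^ 2 ≤ v ⬝ᵥ S *ᵥ v := by
  have hcont : Continuous fun v : ι → ℝ => v ⬝ᵥ S *ᵥ v := by
    simp only [dotProduct, mulVec]; fun_prop
  rcases (Metric.sphere (0 : ι → ℝ) 1).eq_empty_or_nonempty with he | hne
  · refine ⟨1, one_pos, fun v => ?_⟩
    by_cases hv : v = 0
    · simp [hv]
    · exfalso
      have : ‖v‖⁻¹ • v ∈ Metric.sphere (0 : ι → ℝ) 1 := by
        simp [norm_smul, inv_mul_cancel₀ (norm_ne_zero_iff.2 hv)]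
      rw [he] at this
      exact this
  · obtain ⟨w, hw, hmin⟩ := (isCompact_sphere (0 : ι → ℝ) 1).exists_isMinOn hne hcont.continuousOn
    have hw0 : w ≠ 0 := by
      rintro rfl
      simp at hw
    refine ⟨_, hS w hw0, fun v => ?_⟩
    by_cases hv : v = 0
    · simp [hv]
    · have hn : ‖v‖ ≠ 0 := norm_ne_zero_iff.2 hv
      have hmem : ‖v‖⁻¹ • v ∈ Metric.sphere (0 : ι → ℝ) 1 := by
        simp [norm_smul, inv_mul_cancel₀ hn]
      have h1 : w ⬝ᵥ S *ᵥ w ≤ (‖v‖⁻¹ • v) ⬝ᵥ S *ᵥ (‖v‖⁻¹ • v) := hmin hmem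
      simp only [mulVec_smul, smul_dotProduct, dotProduct_smul, smul_eq_mul] at h1
      calc w ⬝ᵥ S *ᵥ w * ‖v‖ ^ 2 ≤ ‖v‖⁻¹ * (‖v‖⁻¹ * v ⬝ᵥ S *ᵥ v) * ‖v‖ ^ 2 := by gcongr
        _ = v ⬝ᵥ S *ᵥ v := by field_simp

end Quadratic

/-- Dynamic programming with nonnegative costs, where `V j` is the optimal cost over the horizon `j`
and `π j` an optimal decision rule. If all value functions are at most `c` times the stage cost `q`,
then `V (j + 2) ≤ (1 + a) V (j + 1)` improves with every step by the factor `1 - 1 / c` in `a`: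
the inequality passes through the dynamic programming step with the loss `a q ≥ (a / c) V (j + 2)`.
Hence the increase of the value function eventually drops below a fraction of `q`. -/
theorem exists_valueFunction_succ_le {X U : Type*} {q : X → ℝ} {r : U → ℝ} {f : X → U → X}
    {V : ℕ → X → ℝ} {π : ℕ → X → U} {c : ℝ} (hq : ∀ v, 0 ≤ q v) (hr : ∀ w, 0 ≤ r w)
    (hV : ∀ j v, 0 ≤ V j v)
    (hopt : ∀ j v, V (j + 1) v = q v + r (π j v) + V j (f v (π j v)))
    (hle : ∀ j v w, V (j + 1) v ≤ q v + r w + V j (f v w))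
    (hc : 1 ≤ c) (hVc : ∀ j v, V j v ≤ c * q v) :
    ∃ j, ∀ v, V (j + 1) v ≤ V j v + q v / 2 := by
  have hc0 : 0 < c := by linarith
  set θ : ℝ := 1 - 1 / c with hθ
  have hθ0 : 0 ≤ θ := by
    rw [hθ, sub_nonneg, div_le_one hc0]; exact hc
  have hθ1 : θ < 1 := by
    have : 0 < 1 / c := by positivity
    linarith
  have key : ∀ j v, V (j + 2) v ≤ (1 + (c - 1) * θ ^ j) * V (j + 1) v := by
    intro j
    induction j with
    | zero =>
      intro v
      have h1 : q v ≤ V 1 v := by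
        rw [hopt 0 v]
        linarith [hr (π 0 v), hV 0 (f v (π 0 v))]
      have h2 := hVc 2 v
      simp only [pow_zero, mul_one, zero_add, add_sub_cancel]
      exact h2.trans (mul_le_mul_of_nonneg_left h1 hc0.le)
    | succ j ih =>
      intro v
      set a : ℝ := (c - 1) * θ ^ j with ha
      have ha0 : 0 ≤ a := mul_nonneg (by linarith) (pow_nonneg hθ0 _)
      set w := π (j + 1) v
      have h1 := hle (j + 2) v w
      have h2 := ih (f v w)
      have h3 := hopt (j + 1) v
      have h4 : V (j + 2) v / c ≤ q v := by
        rw [div_le_iff₀ hc0, mul_comm]; exact hVc (j + 2) v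
      have h5 : a * (V (j + 2) v / c) ≤ a * q v := mul_le_mul_of_nonneg_left h4 ha0
      have h6 : 0 ≤ a * r w := mul_nonneg ha0 (hr w)
      have h7 : (1 + (c - 1) * θ ^ (j + 1)) * V (j + 2) v =
          (1 + a) * V (j + 2) v - a * (V (j + 2) v / c) := by
        rw [pow_succ, ha, hθ]; ring
      show V (j + 3) v ≤ (1 + (c - 1) * θ ^ (j + 1)) * V (j + 2) v
      rw [h7]
      have h8 : (1 + a) * V (j + 2) v =
          (1 + a) * (q v + r w) + (1 + a) * V (j + 1) (f v w) := by
        rw [← mul_add]; exact congrArg _ h3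
      have h9 : V (j + 3) v ≤ q v + r w + V (j + 2) (f v w) := h1
      nlinarith
  obtain ⟨j, hj⟩ : ∃ j, c * (c - 1) * θ ^ j < 1 / 2 := by
    have := (tendsto_pow_atTop_nhds_zero_of_lt_one hθ0 hθ1).const_mul (c * (c - 1))
    rw [mul_zero] at this
    exact (this.eventually (gt_mem_nhds (by norm_num : (0 : ℝ) < 1 / 2))).exists
  refine ⟨j + 1, fun v => ?_⟩
  have h1 := key j v
  have ha0 : 0 ≤ (c - 1) * θ ^ j := mul_nonneg (by linarith) (pow_nonneg hθ0 _)
  have h2 := mul_le_mul_of_nonneg_left (hVc (j + 1) v) ha0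
  have h3 := mul_le_mul_of_nonneg_right hj.le (hq v)
  show V (j + 2) v ≤ _
  nlinarith

section Riccati

variable {ι κ : Type*} [Fintype ι] [Fintype κ]

/-- Completion of the square in the dynamic programming step for `v ↦ F v + G w` with stage cost
`vᵀ Q v + wᵀ R w` and terminal cost `P`: the optimal decision is
`w = -(R + Gᵀ P G)⁻¹ (Fᵀ P G)ᵀ v`. -/
theorem bellman_complete_square [DecidableEq κ] {F : Matrix ι ι ℝ} {G : Matrix ι κ ℝ}
    {Q P : Matrix ι ι ℝ} {R : Matrix κ κ ℝ} (hP : P.IsSymm) (hR : R.IsSymm) (hu : IsUnit (R + Gᵀ * P * G))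
    (v : ι → ℝ) (w : κ → ℝ) :
    v ⬝ᵥ Q *ᵥ v + w ⬝ᵥ R *ᵥ w + (F *ᵥ v + G *ᵥ w) ⬝ᵥ P *ᵥ (F *ᵥ v + G *ᵥ w) =
      v ⬝ᵥ (Q + Fᵀ * P * F - Fᵀ * P * G * (R + Gᵀ * P * G)⁻¹ * (Fᵀ * P * G)ᵀ) *ᵥ v +
        (w + ((R + Gᵀ * P * G)⁻¹ * (Fᵀ * P * G)ᵀ) *ᵥ v) ⬝ᵥ (R + Gᵀ * P * G) *ᵥ
          (w + ((R + Gᵀ * P * G)⁻¹ * (Fᵀ * P * G)ᵀ) *ᵥ v) := by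
  set S := R + Gᵀ * P * G with hS
  set N := Fᵀ * P * G with hN
  have hSs : Sᵀ = S := by
    rw [hS, transpose_add, transpose_mul, transpose_mul, transpose_transpose, hP.eq, hR.eq,
      Matrix.mul_assoc]
  set t := (S⁻¹ * Nᵀ) *ᵥ v with ht
  have hSt : S *ᵥ t = Nᵀ *ᵥ v := by
    rw [ht, mulVec_mulVec, ← Matrix.mul_assoc, mul_nonsing_inv _ ((isUnit_iff_isUnit_det _).1 hu),
      Matrix.one_mul]
  have hNt : v ⬝ᵥ (N * S⁻¹ * Nᵀ) *ᵥ v = t ⬝ᵥ Nᵀ *ᵥ v := by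
    rw [Matrix.mul_assoc, ← mulVec_mulVec, ← ht, dotProduct_mulVec, ← mulVec_transpose,
      dotProduct_comm]
  have htS : t ⬝ᵥ S *ᵥ w = w ⬝ᵥ Nᵀ *ᵥ v := by
    rw [dotProduct_mulVec, ← mulVec_transpose, hSs, hSt, dotProduct_comm]
  have hvPw : (F *ᵥ v) ⬝ᵥ P *ᵥ (G *ᵥ w) = w ⬝ᵥ Nᵀ *ᵥ v := by
    rw [dotProduct_comm w, ← vecMul_transpose Nᵀ, transpose_transpose, ← dotProduct_mulVec, hN,
      ← mulVec_mulVec, ← mulVec_mulVec, dotProduct_mulVec v Fᵀ, vecMul_transpose]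
  have hwPv : (G *ᵥ w) ⬝ᵥ P *ᵥ (F *ᵥ v) = w ⬝ᵥ Nᵀ *ᵥ v := by
    rw [← hvPw, dotProduct_mulVec, ← mulVec_transpose, hP.eq, dotProduct_comm]
  have hvv : v ⬝ᵥ (Fᵀ * P * F) *ᵥ v = (F *ᵥ v) ⬝ᵥ P *ᵥ (F *ᵥ v) := by
    rw [← mulVec_mulVec, ← mulVec_mulVec, dotProduct_mulVec v Fᵀ, vecMul_transpose]
  have hww : w ⬝ᵥ S *ᵥ w = w ⬝ᵥ R *ᵥ w + (G *ᵥ w) ⬝ᵥ P *ᵥ (G *ᵥ w) := by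
    rw [hS, add_mulVec, dotProduct_add, ← mulVec_mulVec, ← mulVec_mulVec, dotProduct_mulVec w Gᵀ,
      vecMul_transpose]
  simp only [mulVec_add, dotProduct_add, add_dotProduct, sub_mulVec, add_mulVec, dotProduct_sub,
    hNt, htS, hSt, hvPw, hwPv, hvv, hww]
  ring

theorem posDef_add_transpose_mul_mul {G : Matrix ι κ ℝ} {P : Matrix ι ι ℝ} {R : Matrix κ κ ℝ}
    (hR : R.PosDef) (hP : P.PosSemidef) : (R + Gᵀ * P * G).PosDef := by
  have := hP.conjTranspose_mul_mul_same G
  rw [conjTranspose_eq_transpose_of_trivial] at this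
  exact hR.add_posSemidef this

theorem isSymm_riccati [DecidableEq κ] {F : Matrix ι ι ℝ} {G : Matrix ι κ ℝ} {Q P : Matrix ι ι ℝ}
    {R : Matrix κ κ ℝ} (hQ : Q.IsSymm) (hP : P.IsSymm) (hR : R.IsSymm) :
    (Q + Fᵀ * P * F -
      Fᵀ * P * G * (R + Gᵀ * P * G)⁻¹ * (Fᵀ * P * G)ᵀ).IsSymm := by
  simp only [IsSymm, transpose_sub, transpose_add, transpose_mul, transpose_transpose,
    transpose_nonsing_inv, hP.eq, hQ.eq, hR.eq, Matrix.mul_assoc]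

/-- Value iteration for a stabilizable linear system with a positive definite stage cost, started
from any positive semidefinite matrix, produces a stabilizing gain: the value functions are bounded
by the cost of a stabilizing feedback, so that `exists_valueFunction_succ_le` provides an iteration
whose value function is a Lyapunov function for its gain. -/
theorem exists_schurStable_of_valueIteration [DecidableEq ι] [DecidableEq κ]
    {F : Matrix ι ι ℝ} {G : Matrix ι κ ℝ}
    {Q : Matrix ι ι ℝ} {R : Matrix κ κ ℝ} (hQ : Q.PosDef) (hR : R.PosDef)
    (hstab : ∃ K : Matrix κ ι ℝ, SchurStable (F - G * K))
    {P : ℕ → Matrix ι ι ℝ} (hP0 : (P 0).PosSemidef)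
    (hP : ∀ j, P (j + 1) = Q + Fᵀ * P j * F -
      Fᵀ * P j * G * (R + Gᵀ * P j * G)⁻¹ * (Fᵀ * P j * G)ᵀ) :
    ∃ j, SchurStable (F - G * ((R + Gᵀ * P j * G)⁻¹ * (Fᵀ * P j * G)ᵀ)) := by
  have hQs : Q.IsSymm := by simpa using hQ.isHermitian
  have hRs : R.IsSymm := by simpa using hR.isHermitian
  have hqpos : ∀ v : ι → ℝ, v ≠ 0 → 0 < v ⬝ᵥ Q *ᵥ v := fun v hv => by
    simpa using hQ.dotProduct_mulVec_pos hv
  have hq : ∀ v : ι → ℝ, 0 ≤ v ⬝ᵥ Q *ᵥ v := fun v => by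
    simpa using hQ.posSemidef.dotProduct_mulVec_nonneg v
  have hr : ∀ w : κ → ℝ, 0 ≤ w ⬝ᵥ R *ᵥ w := fun v => by
    simpa using hR.posSemidef.dotProduct_mulVec_nonneg v
  set K : ℕ → Matrix κ ι ℝ := fun j => (R + Gᵀ * P j * G)⁻¹ * (Fᵀ * P j * G)ᵀ with hK
  have hsq : ∀ j, (P j).PosSemidef → ∀ (v : ι → ℝ) (w : κ → ℝ),
      v ⬝ᵥ Q *ᵥ v + w ⬝ᵥ R *ᵥ w + (F *ᵥ v + G *ᵥ w) ⬝ᵥ P j *ᵥ (F *ᵥ v + G *ᵥ w) =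
        v ⬝ᵥ P (j + 1) *ᵥ v +
          (w + K j *ᵥ v) ⬝ᵥ (R + Gᵀ * P j * G) *ᵥ (w + K j *ᵥ v) := by
    intro j hj v w
    rw [hP j]
    exact bellman_complete_square (by simpa using hj.isHermitian) hRs
      (posDef_add_transpose_mul_mul hR hj).isUnit v w
  have hpsd : ∀ j, (P j).PosSemidef := by
    intro j
    induction j with
    | zero => exact hP0
    | succ j ih =>
      refine PosSemidef.of_dotProduct_mulVec_nonneg ?_ fun v => ?_
      · rw [hP j]
        have := isSymm_riccati (F := F) (G := G) hQs (by simpa using ih.isHermitian : (P j).IsSymm)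
          hRs
        simpa using this
      · have h1 := hsq j ih v (-(K j *ᵥ v))
        rw [neg_add_cancel, zero_dotProduct, add_zero] at h1
        have h2 := ih.dotProduct_mulVec_nonneg (F *ᵥ v + G *ᵥ (-(K j *ᵥ v)))
        rw [star_trivial] at h2 ⊢
        rw [← h1]
        linarith [hq v, hr (-(K j *ᵥ v))]
  have hV : ∀ j (v : ι → ℝ), 0 ≤ v ⬝ᵥ P j *ᵥ v := fun j v => by
    simpa using (hpsd j).dotProduct_mulVec_nonneg v
  have hopt : ∀ j (v : ι → ℝ), v ⬝ᵥ P (j + 1) *ᵥ v =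
      v ⬝ᵥ Q *ᵥ v + (-(K j *ᵥ v)) ⬝ᵥ R *ᵥ (-(K j *ᵥ v)) +
        (F *ᵥ v + G *ᵥ (-(K j *ᵥ v))) ⬝ᵥ P j *ᵥ (F *ᵥ v + G *ᵥ (-(K j *ᵥ v))) := by
    intro j v
    have h1 := hsq j (hpsd j) v (-(K j *ᵥ v))
    rw [neg_add_cancel, zero_dotProduct, add_zero] at h1
    exact h1.symm
  have hle : ∀ j (v : ι → ℝ) (w : κ → ℝ), v ⬝ᵥ P (j + 1) *ᵥ v ≤
      v ⬝ᵥ Q *ᵥ v + w ⬝ᵥ R *ᵥ w + (F *ᵥ v + G *ᵥ w) ⬝ᵥ P j *ᵥ (F *ᵥ v + G *ᵥ w) := by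
    intro j v w
    rw [hsq j (hpsd j) v w]
    have := (posDef_add_transpose_mul_mul (G := G) hR (hpsd j)).posSemidef.dotProduct_mulVec_nonneg
      (w + K j *ᵥ v)
    rw [star_trivial] at this
    linarith
  -- The cost of the stabilizing feedback `w = -Ks v` bounds all value functions.
  obtain ⟨Ks, hKs⟩ := hstab
  obtain ⟨d, ρ, hd, hρ0, hρ1, hpow⟩ := hKs.exists_pow_bound
  set Fs := F - G * Ks with hFs
  obtain ⟨g, hg0, hg⟩ := exists_quadratic_le_norm_sq (Q + Ksᵀ * R * Ks)
  obtain ⟨g₀, hg₀0, hg₀⟩ := exists_quadratic_le_norm_sq (P 0)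
  obtain ⟨e, he0, he⟩ := exists_norm_sq_le_quadratic hqpos
  have hstep : ∀ j (v : ι → ℝ), v ⬝ᵥ P (j + 1) *ᵥ v ≤
      g * ‖v‖ ^ 2 + (Fs *ᵥ v) ⬝ᵥ P j *ᵥ (Fs *ᵥ v) := by
    intro j v
    have h1 := hle j v (-(Ks *ᵥ v))
    have h2 : F *ᵥ v + G *ᵥ (-(Ks *ᵥ v)) = Fs *ᵥ v := by
      rw [hFs, sub_mulVec, mulVec_neg, ← mulVec_mulVec, sub_eq_add_neg]
    have h3 : v ⬝ᵥ Q *ᵥ v + (-(Ks *ᵥ v)) ⬝ᵥ R *ᵥ (-(Ks *ᵥ v)) =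
        v ⬝ᵥ (Q + Ksᵀ * R * Ks) *ᵥ v := by
      rw [add_mulVec, dotProduct_add, ← mulVec_mulVec, ← mulVec_mulVec, dotProduct_mulVec v Ksᵀ,
        vecMul_transpose, mulVec_neg, neg_dotProduct_neg]
    rw [h2, h3] at h1
    linarith [hg v]
  have hsum : ∀ j (v : ι → ℝ), v ⬝ᵥ P j *ᵥ v ≤
      (∑ i ∈ Finset.range j, g * ‖Fs ^ i *ᵥ v‖ ^ 2) + g₀ * ‖Fs ^ j *ᵥ v‖ ^ 2 := by
    intro j
    induction j with
    | zero => intro v; simpa using hg₀ v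
    | succ j ih =>
      intro v
      have h1 := hstep j v
      have h2 := ih (Fs *ᵥ v)
      simp only [mulVec_mulVec, ← pow_succ] at h2
      rw [Finset.sum_range_succ']
      simp only [pow_zero, one_mulVec]
      rw [mulVec_mulVec] at h1
      linarith
  have hpow2 : ∀ i (v : ι → ℝ), ‖Fs ^ i *ᵥ v‖ ^ 2 ≤ d ^ 2 * ‖v‖ ^ 2 * (ρ ^ 2) ^ i := by
    intro i v
    calc ‖Fs ^ i *ᵥ v‖ ^ 2 ≤ (d * ρ ^ i * ‖v‖) ^ 2 := by gcongr; exact hpow i v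
      _ = d ^ 2 * ‖v‖ ^ 2 * (ρ ^ 2) ^ i := by ring
  have hρ2 : ρ ^ 2 < 1 := by nlinarith
  have hgeom : ∀ j, ∑ i ∈ Finset.range j, (ρ ^ 2) ^ i ≤ (1 - ρ ^ 2)⁻¹ := fun j =>
    sum_le_hasSum _ (fun i _ => by positivity) (hasSum_geometric_of_lt_one (sq_nonneg ρ) hρ2)
  set b : ℝ := (g * (1 - ρ ^ 2)⁻¹ + g₀) * d ^ 2 with hb
  have hinv : 0 ≤ (1 - ρ ^ 2)⁻¹ := inv_nonneg.2 (by linarith)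
  have hb0 : 0 ≤ b := by positivity
  have hVb : ∀ j (v : ι → ℝ), v ⬝ᵥ P j *ᵥ v ≤ b * ‖v‖ ^ 2 := by
    intro j v
    refine (hsum j v).trans ?_
    have h1 : ∑ i ∈ Finset.range j, g * ‖Fs ^ i *ᵥ v‖ ^ 2 ≤
        g * (d ^ 2 * ‖v‖ ^ 2 * (1 - ρ ^ 2)⁻¹) := by
      rw [← Finset.mul_sum]
      refine mul_le_mul_of_nonneg_left ?_ hg0
      refine (Finset.sum_le_sum fun i _ => hpow2 i v).trans ?_
      rw [← Finset.mul_sum]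
      exact mul_le_mul_of_nonneg_left (hgeom j) (by positivity)
    have h2 : g₀ * ‖Fs ^ j *ᵥ v‖ ^ 2 ≤ g₀ * (d ^ 2 * ‖v‖ ^ 2 * 1) := by
      refine mul_le_mul_of_nonneg_left ((hpow2 j v).trans ?_) hg₀0
      exact mul_le_mul_of_nonneg_left (pow_le_one₀ (sq_nonneg ρ) hρ2.le) (by positivity)
    rw [hb]
    linarith
  have hVc : ∀ j (v : ι → ℝ), v ⬝ᵥ P j *ᵥ v ≤ (1 + b / e) * v ⬝ᵥ Q *ᵥ v := by
    intro j v
    have h1 : b / e * (e * ‖v‖ ^ 2) ≤ b / e * (v ⬝ᵥ Q *ᵥ v) :=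
      mul_le_mul_of_nonneg_left (he v) (by positivity)
    rw [← mul_assoc, div_mul_cancel₀ _ he0.ne'] at h1
    linarith [hVb j v, hq v]
  obtain ⟨j, hj⟩ := exists_valueFunction_succ_le (q := fun v => v ⬝ᵥ Q *ᵥ v)
    (r := fun w => w ⬝ᵥ R *ᵥ w) (f := fun v w => F *ᵥ v + G *ᵥ w) (V := fun j v => v ⬝ᵥ P j *ᵥ v)
    (π := fun j v => -(K j *ᵥ v)) hq hr hV hopt hle
    (by linarith [div_nonneg hb0 he0.le] : 1 ≤ 1 + b / e) hVc
  refine ⟨j, SchurStable.of_quadratic_decrease (hV j) fun v hv => ?_⟩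
  have h1 := hj v
  rw [hopt j v] at h1
  have h2 : F *ᵥ v + G *ᵥ (-(K j *ᵥ v)) = (F - G * K j) *ᵥ v := by
    rw [sub_mulVec, mulVec_neg, mulVec_mulVec, sub_eq_add_neg]
  rw [h2] at h1
  linarith [hqpos v hv, hr (-(K j *ᵥ v))]

end Riccati

/-! ### Half-vectorization and the data equations -/

section Vech

variable {ι κ : Type*}

theorem vech_mk {S : Matrix ι ι ℝ} (hS : S.IsSymm) (i j : ι) : vech S s(i, j) = S i j := by
  have h : S j i = S i j := hS.apply i j
  show (S i j + S j i) / 2 = S i j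
  rw [h]; ring

theorem eq_of_vech_eq {S T : Matrix ι ι ℝ} (hS : S.IsSymm) (hT : T.IsSymm) (h : vech S = vech T) :
    S = T := by
  ext i j
  rw [← vech_mk hS, h, vech_mk hT]

variable [Fintype ι] [Fintype κ]

/-- The sum over ordered pairs is collected over unordered pairs: the fibre over `{i, j}` consists
of `(i, j)` and `(j, i)`, which coincide on the diagonal. -/
theorem delta_dotProduct_vech [DecidableEq ι] {S : Matrix ι ι ℝ} (hS : S.IsSymm) (v : ι → ℝ) :
    delta v ⬝ᵥ vech S = v ⬝ᵥ S *ᵥ v := by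
  have h : v ⬝ᵥ S *ᵥ v = ∑ q : ι × ι, v q.1 * (S q.1 q.2 * v q.2) := by
    simp only [dotProduct, mulVec, Finset.mul_sum, Fintype.sum_prod_type]
  rw [h, ← Finset.sum_fiberwise Finset.univ (fun q : ι × ι => s(q.1, q.2)), dotProduct]
  refine Finset.sum_congr rfl fun s _ => ?_
  induction s using Sym2.ind with
  | _ i j =>
  have hf : (Finset.univ.filter fun q : ι × ι => s(q.1, q.2) = s(i, j)) = {(i, j), (j, i)} := by
    ext ⟨a, b⟩
    simp
  have hsym : S j i = S i j := hS.apply i j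
  have hδ : delta v s(i, j) = if i = j then v i * v i else 2 * (v i * v j) := by
    rw [delta, vech_mk]
    · simp only [Matrix.sub_apply, Matrix.smul_apply, vecMulVec_apply, smul_eq_mul, diagonal_pow,
        Matrix.diagonal_apply, Pi.pow_apply]
      split_ifs with hij
      · subst hij; ring
      · ring
    · simp only [IsSymm, transpose_sub, transpose_smul, transpose_vecMulVec, diagonal_pow,
        diagonal_transpose]
  rw [hf, hδ, vech_mk hS]
  split_ifs with hij
  · subst hij
    simp only [Finset.pair_eq_singleton, Finset.sum_singleton]; ring
  · rw [Finset.sum_pair (by simp [Prod.ext_iff, hij]), hsym]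
    ring

theorem deltaCross_dotProduct_vec (Y : Matrix ι κ ℝ) (v : ι → ℝ) (w : κ → ℝ) :
    deltaCross v w ⬝ᵥ Y.vec = v ⬝ᵥ Y *ᵥ w := by
  simp only [dotProduct, mulVec, deltaCross, vec, Fintype.sum_prod_type, Finset.mul_sum]
  rw [Finset.sum_comm]
  exact Finset.sum_congr rfl fun i _ => Finset.sum_congr rfl fun j _ => by ring

end Vech

theorem mulVec_injective_of_rank_eq_card {ι κ K : Type*} [Fintype ι] [Fintype κ] [Field K]
    {D : Matrix ι κ K} (h : D.rank = Fintype.card κ) : Function.Injective D.mulVec := by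
  have h1 := D.mulVecLin.finrank_range_add_finrank_ker
  have h2 : Module.finrank K (LinearMap.range D.mulVecLin) = Fintype.card κ := h
  rw [h2, Module.finrank_fintype_fun_eq_card] at h1
  have h3 : LinearMap.ker D.mulVecLin = ⊥ := Submodule.finrank_eq_zero.1 (by omega)
  exact LinearMap.ker_eq_bot.1 h3

theorem card_thetaIdx (n m p : ℕ) : Fintype.card (ThetaIdx n m p) =
    (n * (m + p + 1) + m) * (n * (m + p + 1) + m + 1) / 2 := by
  have hN : Fintype.card (EtaIdx n m p) = n * (m + p + 1) := by
    simp only [Fintype.card_sum, Fintype.card_prod, Fintype.card_fin]; ring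
  rw [Fintype.card_sum, Fintype.card_sum, Sym2.card, Sym2.card, Fintype.card_prod, hN,
    Fintype.card_fin, Nat.choose_two_right, Nat.choose_two_right, Nat.add_sub_cancel,
    Nat.add_sub_cancel]
  generalize n * (m + p + 1) = N
  have h1 := Nat.div_mul_cancel (Nat.even_mul_succ_self N).two_dvd
  have h2 := Nat.div_mul_cancel (Nat.even_mul_succ_self m).two_dvd
  symm
  apply Nat.div_eq_of_eq_mul_left two_pos
  rw [mul_comm N] at h1
  rw [mul_comm m] at h2
  nlinarith

section Data

variable {n m p : ℕ}

/-- The Bellman equation along data that satisfy `η(k+1) = F η(k) + G u(k)` and `y(k) = E η(k)`: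
the matrices of the Riccati recursion solve the learning equation. -/
theorem dataPi_mulVec_riccati {F : Matrix (EtaIdx n m p) (EtaIdx n m p) ℝ}
    {G : Matrix (EtaIdx n m p) (Fin m) ℝ} {E : Matrix (Fin p) (EtaIdx n m p) ℝ}
    {Qε : Matrix (EtaIdx n m p) (EtaIdx n m p) ℝ} {Qy : Matrix (Fin p) (Fin p) ℝ}
    {R : Matrix (Fin m) (Fin m) ℝ} {P : Matrix (EtaIdx n m p) (EtaIdx n m p) ℝ}
    (hQε : Qε.IsSymm) (hQy : Qy.IsSymm) (hR : R.IsSymm) (hP : P.IsSymm) {kN : ℕ}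
    {η : ℕ → EtaIdx n m p → ℝ} {y : ℕ → Fin p → ℝ} {u : ℕ → Fin m → ℝ}
    (hη : ∀ k, η (k + 1) = F *ᵥ η k + G *ᵥ u k) (hy : ∀ k, y k = E *ᵥ η k) :
    dataPi kN η u *ᵥ Sum.elim (vech (Qε + Eᵀ * Qy * E + Fᵀ * P * F))
        (Sum.elim (Fᵀ * P * G).vec (vech (R + Gᵀ * P * G))) =
      dataPsi kN η *ᵥ vech P + fun k : Fin (kN + 1) => utility Qε Qy R (η k) (y k) (u k) := by
  have hs1 : (Qε + Eᵀ * Qy * E + Fᵀ * P * F).IsSymm := by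
    simp only [IsSymm, transpose_add, transpose_mul, transpose_transpose, hP.eq, hQε.eq, hQy.eq,
      Matrix.mul_assoc]
  have hs2 : (R + Gᵀ * P * G).IsSymm := by
    simp only [IsSymm, transpose_add, transpose_mul, transpose_transpose, hP.eq, hR.eq,
      Matrix.mul_assoc]
  ext k
  have hl : (dataPi kN η u *ᵥ Sum.elim (vech (Qε + Eᵀ * Qy * E + Fᵀ * P * F))
        (Sum.elim (Fᵀ * P * G).vec (vech (R + Gᵀ * P * G)))) k =
      delta (η k) ⬝ᵥ vech (Qε + Eᵀ * Qy * E + Fᵀ * P * F) +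
        (2 * (deltaCross (η k) (u k) ⬝ᵥ (Fᵀ * P * G).vec) +
          delta (u k) ⬝ᵥ vech (R + Gᵀ * P * G)) := by
    show Sum.elim (delta (η k)) (Sum.elim ((2 : ℝ) • deltaCross (η k) (u k)) (delta (u k))) ⬝ᵥ
      Sum.elim _ (Sum.elim _ _) = _
    rw [sumElim_dotProduct_sumElim, sumElim_dotProduct_sumElim, smul_dotProduct, smul_eq_mul]
  have hr : (dataPsi kN η *ᵥ vech P) k = delta (η (k + 1)) ⬝ᵥ vech P := rfl
  rw [hl, Pi.add_apply, hr, delta_dotProduct_vech hs1, delta_dotProduct_vech hs2,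
    delta_dotProduct_vech hP, deltaCross_dotProduct_vec, utility, hη, hy]
  have e1 : ∀ {a b : Type} [Fintype a] [Fintype b] (X : Matrix b a ℝ) (Y : Matrix b b ℝ)
      (v : a → ℝ), v ⬝ᵥ (Xᵀ * Y * X) *ᵥ v = (X *ᵥ v) ⬝ᵥ Y *ᵥ (X *ᵥ v) := by
    intro a b _ _ X Y v
    rw [← mulVec_mulVec, ← mulVec_mulVec, dotProduct_mulVec v Xᵀ, vecMul_transpose]
  have e2 : η k ⬝ᵥ (Fᵀ * P * G) *ᵥ u k = (F *ᵥ η k) ⬝ᵥ P *ᵥ (G *ᵥ u k) := by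
    rw [← mulVec_mulVec, ← mulVec_mulVec, dotProduct_mulVec (η k) Fᵀ, vecMul_transpose]
  have e3 : (G *ᵥ u k) ⬝ᵥ P *ᵥ (F *ᵥ η k) = (F *ᵥ η k) ⬝ᵥ P *ᵥ (G *ᵥ u k) := by
    rw [dotProduct_mulVec, ← mulVec_transpose, hP.eq, dotProduct_comm]
  simp only [add_mulVec, dotProduct_add, e1, e2, mulVec_add, add_dotProduct, e3]
  ring

/-- If the data matrix is injective, then the matrices of the Riccati recursion are the only symmetric
solution of the learning equation. -/
theorem eq_riccati_of_learning {F : Matrix (EtaIdx n m p) (EtaIdx n m p) ℝ}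
    {G : Matrix (EtaIdx n m p) (Fin m) ℝ} {E : Matrix (Fin p) (EtaIdx n m p) ℝ}
    {Qε : Matrix (EtaIdx n m p) (EtaIdx n m p) ℝ} {Qy : Matrix (Fin p) (Fin p) ℝ}
    {R : Matrix (Fin m) (Fin m) ℝ} {P : Matrix (EtaIdx n m p) (EtaIdx n m p) ℝ}
    (hQε : Qε.IsSymm) (hQy : Qy.IsSymm) (hR : R.IsSymm) (hP : P.IsSymm) {kN : ℕ}
    {η : ℕ → EtaIdx n m p → ℝ} {y : ℕ → Fin p → ℝ} {u : ℕ → Fin m → ℝ}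
    (hη : ∀ k, η (k + 1) = F *ᵥ η k + G *ᵥ u k) (hy : ∀ k, y k = E *ᵥ η k)
    (hinj : Function.Injective (dataPi kN η u).mulVec)
    {Xηη : Matrix (EtaIdx n m p) (EtaIdx n m p) ℝ} {Xηu : Matrix (EtaIdx n m p) (Fin m) ℝ}
    {Xuu : Matrix (Fin m) (Fin m) ℝ} (hXηη : Xηη.IsSymm) (hXuu : Xuu.IsSymm)
    (h : dataPi kN η u *ᵥ Sum.elim (vech Xηη) (Sum.elim Xηu.vec (vech Xuu)) =
      dataPsi kN η *ᵥ vech P + fun k : Fin (kN + 1) => utility Qε Qy R (η k) (y k) (u k)) :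
    Xηη = Qε + Eᵀ * Qy * E + Fᵀ * P * F ∧ Xηu = Fᵀ * P * G ∧ Xuu = R + Gᵀ * P * G := by
  have he := hinj (h.trans (dataPi_mulVec_riccati hQε hQy hR hP hη hy).symm)
  refine ⟨eq_of_vech_eq hXηη ?_ (funext fun s => congrFun he (Sum.inl s)), ?_,
    eq_of_vech_eq hXuu ?_ (funext fun s => congrFun he (Sum.inr (Sum.inr s)))⟩
  · simp only [IsSymm, transpose_add, transpose_mul, transpose_transpose, hP.eq, hQε.eq, hQy.eq,
      Matrix.mul_assoc]
  · exact vec_inj.1 (funext fun s => congrFun he (Sum.inr (Sum.inl s)))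
  · simp only [IsSymm, transpose_add, transpose_mul, transpose_transpose, hP.eq, hR.eq,
      Matrix.mul_assoc]

end Data

/-! ### The plant state as a function of the internal state -/

/-- The embedding `u ↦ col(u, 0, 0)` of the inputs into the signals that drive the internal
model. -/
def inputSel (m p : ℕ) : Matrix (ZetaIdx m p) (Fin m) ℝ := fromRows (fromRows 1 0) 0

/-- The embedding `y ↦ col(0, y, 0)` of the outputs into the signals that drive the internal
model. -/
def outputSel (m p : ℕ) : Matrix (ZetaIdx m p) (Fin p) ℝ := fromRows (fromRows 0 1) 0

theorem zeta_eq {m p : ℕ} (u : Fin m → ℝ) (y : Fin p → ℝ) :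
    zeta u y = inputSel m p *ᵥ u + outputSel m p *ᵥ y := by
  simp only [inputSel, outputSel, fromRows_mulVec]
  ext ((i | i) | i) <;> simp [zeta]

section Parameterization

variable {n m p : ℕ} {AL Aε : Matrix (Fin n) (Fin n) ℝ} {B : Matrix (Fin n) (Fin m) ℝ}
  {L : Matrix (Fin n) (Fin p) ℝ} {x0 : Fin n → ℝ} {η0 : EtaIdx n m p → ℝ}

theorem Mobs_mul_kronecker :
    Mobs AL B L * ((1 : Matrix (Fin m ⊕ Fin p) (Fin m ⊕ Fin p) ℝ) ⊗ₖ companionOf AL) =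
      AL * Mobs AL B L := by
  ext i ⟨c, l⟩
  have h := congrFun (congrFun (mul_adjCoeff AL fun r => fromCols B L r c) i) l
  have hR : (AL * Mobs AL B L) i (c, l) = (AL * adjCoeff AL fun r => fromCols B L r c) i l := rfl
  rw [hR, h, mul_apply, mul_apply, Fintype.sum_prod_type, Finset.sum_eq_single c]
  · simp [Mobs]
  · intro b _ hb
    simp [Matrix.one_apply_ne hb]
  · simp

theorem paramMatrix_mul_G1 (hε : Aε.charpoly = AL.charpoly)
    (hη : IsUnit (adjCoeff Aε (η0 ∘ Sum.inr))) :
    paramMatrix AL Aε B L x0 η0 * G1 m p AL Aε = AL * paramMatrix AL Aε B L x0 η0 := by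
  have hdet := (isUnit_iff_isUnit_det _).1 hη
  have h1 := mul_adjCoeff Aε (η0 ∘ Sum.inr)
  set N := adjCoeff Aε (η0 ∘ Sum.inr)
  have h2 : companionOf AL * N⁻¹ = N⁻¹ * Aε := by
    calc companionOf AL * N⁻¹ = N⁻¹ * (N * companionOf Aε) * N⁻¹ := by
          rw [nonsing_inv_mul_cancel_left _ _ hdet, companionOf_congr hε]
      _ = N⁻¹ * Aε := by
          rw [← h1, Matrix.mul_assoc, Matrix.mul_assoc, mul_nonsing_inv _ hdet, Matrix.mul_one]
  rw [paramMatrix, G1, fromCols_mul_fromBlocks, mul_fromCols, Mobs_mul_kronecker]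
  congr 1
  · simp
  · rw [Matrix.mul_zero, zero_add, Matrix.mul_assoc, ← h2, ← Matrix.mul_assoc, ← mul_adjCoeff,
      Matrix.mul_assoc]

theorem paramMatrix_mul_G2 :
    paramMatrix AL Aε B L x0 η0 * G2 n m p = fromCols (fromCols B L) 0 := by
  rw [paramMatrix, G2, fromCols_mul_fromBlocks]
  congr 1
  · ext i c
    have h := congrFun (adjCoeff_mulVec_lastVec AL fun r => fromCols B L r c) i
    rw [← h, Matrix.mul_zero, add_zero, mul_apply, Fintype.sum_prod_type, Finset.sum_eq_single c]
    · simp [Mobs, mulVec, dotProduct]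
    · intro b _ hb
      simp [hb]
    · simp
  · simp

theorem paramMatrix_mul_input :
    paramMatrix AL Aε B L x0 η0 * (G2 n m p * inputSel m p) = B := by
  rw [← Matrix.mul_assoc, paramMatrix_mul_G2, inputSel, fromCols_mul_fromRows,
    fromCols_mul_fromRows]
  simp

theorem paramMatrix_mul_output :
    paramMatrix AL Aε B L x0 η0 * (G2 n m p * outputSel m p) = L := by
  rw [← Matrix.mul_assoc, paramMatrix_mul_G2, outputSel, fromCols_mul_fromRows,
    fromCols_mul_fromRows]
  simp

theorem paramMatrix_mulVec_init (hη : IsUnit (adjCoeff Aε (η0 ∘ Sum.inr))) :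
    paramMatrix AL Aε B L x0 η0 *ᵥ η0 = x0 := by
  have hdet := (isUnit_iff_isUnit_det _).1 hη
  have h1 := adjCoeff_mulVec_lastVec Aε (η0 ∘ Sum.inr)
  have h2 : (adjCoeff Aε (η0 ∘ Sum.inr))⁻¹ *ᵥ (η0 ∘ Sum.inr) = lastVec n := by
    conv_lhs => rw [← h1]
    rw [h1, ← h1, mulVec_mulVec, h1, nonsing_inv_mul _ hdet, one_mulVec]
  rw [paramMatrix, fromCols_mulVec, ← mulVec_mulVec, h2, adjCoeff_mulVec_lastVec, errorInit,
    add_sub_cancel]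

end Parameterization

section ReducedModel

variable {n m p : ℕ} {A : Matrix (Fin n) (Fin n) ℝ} {B : Matrix (Fin n) (Fin m) ℝ}
  {C : Matrix (Fin p) (Fin n) ℝ} {L : Matrix (Fin n) (Fin p) ℝ} {Aε : Matrix (Fin n) (Fin n) ℝ}
  {M : Matrix (Fin n) (EtaIdx n m p) ℝ}

/-- The state matrix of the internal model once the output is expressed as `y = C M η`. -/
noncomputable def reducedStateMatrix (A : Matrix (Fin n) (Fin n) ℝ) (C : Matrix (Fin p) (Fin n) ℝ)
    (L : Matrix (Fin n) (Fin p) ℝ) (Aε : Matrix (Fin n) (Fin n) ℝ)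
    (M : Matrix (Fin n) (EtaIdx n m p) ℝ) : Matrix (EtaIdx n m p) (EtaIdx n m p) ℝ :=
  G1 m p (A - L * C) Aε + G2 n m p * outputSel m p * C * M

theorem mul_reducedStateMatrix (h1 : M * G1 m p (A - L * C) Aε = (A - L * C) * M)
    (hL : M * (G2 n m p * outputSel m p) = L) : M * reducedStateMatrix A C L Aε M = A * M := by
  rw [reducedStateMatrix, Matrix.mul_add, h1, ← Matrix.mul_assoc, ← Matrix.mul_assoc, hL,
    ← Matrix.add_mul, sub_add_cancel]

theorem exists_schurStable_reduced (hAB : Stabilizable A B)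
    (hG : SchurStable (G1 m p (A - L * C) Aε))
    (h1 : M * G1 m p (A - L * C) Aε = (A - L * C) * M)
    (hB : M * (G2 n m p * inputSel m p) = B) (hL : M * (G2 n m p * outputSel m p) = L) :
    ∃ K : Matrix (Fin m) (EtaIdx n m p) ℝ,
      SchurStable (reducedStateMatrix A C L Aε M - G2 n m p * inputSel m p * K) := by
  obtain ⟨K, hK⟩ := hAB
  refine ⟨K * M, ?_⟩
  have he : reducedStateMatrix A C L Aε M - G2 n m p * inputSel m p * (K * M) =
      G1 m p (A - L * C) Aε + (G2 n m p * outputSel m p * C - G2 n m p * inputSel m p * K) * M := by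
    rw [reducedStateMatrix, Matrix.sub_mul, Matrix.mul_assoc _ K M, add_sub_assoc]
  have hint : M * (reducedStateMatrix A C L Aε M - G2 n m p * inputSel m p * (K * M)) =
      (A - B * K) * M := by
    rw [Matrix.mul_sub, mul_reducedStateMatrix h1 hL, ← Matrix.mul_assoc, hB, Matrix.sub_mul,
      Matrix.mul_assoc]
  rw [he] at hint ⊢
  exact hG.add_mul hK hint

/-- The internal state determines the plant state along the data: `M η` and `x` both evolve by
`z ↦ (A - L C) z + B u + L y`, and they agree initially. -/
theorem state_eq_mulVec {x : ℕ → Fin n → ℝ} {u : ℕ → Fin m → ℝ} {y : ℕ → Fin p → ℝ}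
    {η : ℕ → EtaIdx n m p → ℝ} (hdata : IsTrajectory A B C L Aε x u y η)
    (h1 : M * G1 m p (A - L * C) Aε = (A - L * C) * M)
    (hB : M * (G2 n m p * inputSel m p) = B) (hL : M * (G2 n m p * outputSel m p) = L)
    (h0 : M *ᵥ η 0 = x 0) (k : ℕ) : M *ᵥ η k = x k := by
  induction k with
  | zero => exact h0
  | succ k ih =>
    rw [hdata.internal, hdata.state, zeta_eq, mulVec_add, mulVec_add, mulVec_add, mulVec_mulVec, h1,
      mulVec_mulVec, mulVec_mulVec, mulVec_mulVec, mulVec_mulVec, Matrix.mul_assoc M,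
      Matrix.mul_assoc M, hB, hL, ← mulVec_mulVec, ih,
      hdata.output, sub_mulVec, ← mulVec_mulVec]
    abel

theorem internal_eq_reduced {x : ℕ → Fin n → ℝ} {u : ℕ → Fin m → ℝ} {y : ℕ → Fin p → ℝ}
    {η : ℕ → EtaIdx n m p → ℝ} (hdata : IsTrajectory A B C L Aε x u y η)
    (hx : ∀ k, M *ᵥ η k = x k) (k : ℕ) :
    η (k + 1) = reducedStateMatrix A C L Aε M *ᵥ η k + (G2 n m p * inputSel m p) *ᵥ u k := by
  rw [hdata.internal, zeta_eq, reducedStateMatrix, add_mulVec, mulVec_add, hdata.output,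
    ← mulVec_mulVec (η k), hx, mulVec_mulVec, mulVec_mulVec, mulVec_mulVec]
  abel

end ReducedModel

/-! ### The closed loop -/

theorem norm_sumElim {α β : Type*} [Fintype α] [Fintype β] (s : (α → ℝ) × (β → ℝ)) :
    ‖Sum.elim s.1 s.2‖ = ‖s‖ := by
  refine le_antisymm ((pi_norm_le_iff_of_nonneg (norm_nonneg _)).2 ?_) ?_
  · rintro (i | i)
    · exact (norm_le_pi_norm s.1 i).trans (norm_fst_le s)
    · exact (norm_le_pi_norm s.2 i).trans (norm_snd_le s)
  · refine max_le ?_ ?_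
    · exact (pi_norm_le_iff_of_nonneg (norm_nonneg _)).2 fun i =>
        norm_le_pi_norm (Sum.elim s.1 s.2) (Sum.inl i)
    · exact (pi_norm_le_iff_of_nonneg (norm_nonneg _)).2 fun i =>
        norm_le_pi_norm (Sum.elim s.1 s.2) (Sum.inr i)

theorem SchurStable.asymptoticallyStable {α β : Type*} [Fintype α] [Fintype β] [DecidableEq α]
    [DecidableEq β] {W : Matrix (α ⊕ β) (α ⊕ β) ℝ} (hW : SchurStable W)
    {f : (α → ℝ) × (β → ℝ) → (α → ℝ) × (β → ℝ)}
    (hf : ∀ s, Sum.elim (f s).1 (f s).2 = W *ᵥ Sum.elim s.1 s.2) : AsymptoticallyStable f := by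
  have hiter : ∀ (k : ℕ) s,
      Sum.elim (f^[k] s).1 (f^[k] s).2 = W ^ k *ᵥ Sum.elim s.1 s.2 := by
    intro k s
    induction k with
    | zero => simp
    | succ k ih => rw [Function.iterate_succ_apply', hf, ih, mulVec_mulVec, pow_succ']
  obtain ⟨c, r, hc, hr0, hr1, hb⟩ := hW.exists_pow_bound
  have hbound : ∀ (k : ℕ) s, ‖f^[k] s‖ ≤ c * r ^ k * ‖s‖ := by
    intro k s
    rw [← norm_sumElim, ← norm_sumElim s, hiter]
    exact hb k _
  refine ⟨fun ε hε => ⟨ε / (c + 1), by positivity, fun z hz k => ?_⟩, fun z => ?_⟩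
  · calc ‖f^[k] z‖ ≤ c * r ^ k * ‖z‖ := hbound k z
      _ ≤ c * 1 * ‖z‖ := by gcongr; exact pow_le_one₀ hr0 hr1.le
      _ ≤ (c + 1) * ‖z‖ := by nlinarith [norm_nonneg z]
      _ < ε := by rwa [lt_div_iff₀ (by positivity), mul_comm] at hz
  · refine squeeze_zero_norm (fun k => hbound k z) ?_
    have := ((tendsto_pow_atTop_nhds_zero_of_lt_one hr0 hr1).const_mul c).mul_const ‖z‖
    simpa using this

section ClosedLoop

variable {n m p : ℕ} {A : Matrix (Fin n) (Fin n) ℝ} {B : Matrix (Fin n) (Fin m) ℝ}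
  {C : Matrix (Fin p) (Fin n) ℝ} {L : Matrix (Fin n) (Fin p) ℝ} {Aε : Matrix (Fin n) (Fin n) ℝ}
  {M : Matrix (Fin n) (EtaIdx n m p) ℝ} {K : Matrix (Fin m) (EtaIdx n m p) ℝ}

/-- Separation principle: the error `x - M η` evolves with the observer matrix, and on the subspace
`x = M η` the closed loop is the reduced model under state feedback. -/
theorem asymptoticallyStable_closedLoop (hAL : SchurStable (A - L * C))
    (h1 : M * G1 m p (A - L * C) Aε = (A - L * C) * M)
    (hB : M * (G2 n m p * inputSel m p) = B) (hL : M * (G2 n m p * outputSel m p) = L)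
    (hK : SchurStable (reducedStateMatrix A C L Aε M - G2 n m p * inputSel m p * K)) :
    AsymptoticallyStable (closedLoop A B C L Aε K) := by
  set U := G2 n m p * inputSel m p with hU
  set Y := G2 n m p * outputSel m p with hY
  set Fr := reducedStateMatrix A C L Aε M with hFr
  set W : Matrix (Fin n ⊕ EtaIdx n m p) (Fin n ⊕ EtaIdx n m p) ℝ :=
    fromBlocks A (-(B * K)) (Y * C) (G1 m p (A - L * C) Aε - U * K) with hWdef
  have htri : SchurStable (fromBlocks 0 (A * M - B * K) 0 (Fr - U * K) :
      Matrix (Fin n ⊕ EtaIdx n m p) (Fin n ⊕ EtaIdx n m p) ℝ) := by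
    have he : (fromBlocks 0 (A * M - B * K) 0 (Fr - U * K) :
        Matrix (Fin n ⊕ EtaIdx n m p) (Fin n ⊕ EtaIdx n m p) ℝ) =
        0 + fromRows (A * M - B * K) (Fr - U * K) *
          (fromCols 0 1 : Matrix (EtaIdx n m p) (Fin n ⊕ EtaIdx n m p) ℝ) := by
      rw [zero_add, fromRows_mul_fromCols]
      simp
    rw [he]
    refine SchurStable.zero.add_mul hK ?_
    rw [← he, fromCols_mul_fromBlocks, mul_fromCols]
    simp
  have hWS : SchurStable W := by
    have he : W = fromBlocks 0 (A * M - B * K) 0 (Fr - U * K) +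
        fromRows A (Y * C) * fromCols 1 (-M) := by
      rw [fromRows_mul_fromCols, fromBlocks_add, hWdef, hFr, reducedStateMatrix, ← hY]
      congr 1
      · simp
      · rw [Matrix.mul_neg]; abel
      · simp
      · rw [Matrix.mul_neg]; abel
    rw [he]
    refine htri.add_mul hAL ?_
    rw [← he, hWdef, fromCols_mul_fromBlocks, mul_fromCols]
    congr 1
    · rw [Matrix.one_mul, Matrix.mul_one, Matrix.neg_mul, ← Matrix.mul_assoc, hL, sub_eq_add_neg]
    · rw [Matrix.one_mul, Matrix.neg_mul, Matrix.mul_sub, h1, ← Matrix.mul_assoc, hB,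
        Matrix.mul_neg]
      abel
  refine hWS.asymptoticallyStable fun s => ?_
  rw [hWdef, fromBlocks_mulVec]
  simp only [closedLoop, zeta_eq, mulVec_add, mulVec_neg, neg_mulVec, sub_mulVec, mulVec_mulVec,
    Sum.elim_comp_inl, Sum.elim_comp_inr, ← Matrix.mul_assoc, ← hU, ← hY]
  congr 1
  abel

end ClosedLoop

/-! ### Stabilization by value iteration -/

theorem theorem6 {n m p : ℕ}
    (A : Matrix (Fin n) (Fin n) ℝ) (B : Matrix (Fin n) (Fin m) ℝ) (C : Matrix (Fin p) (Fin n) ℝ)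
    (hAB : Stabilizable A B) (hAC : Observable A C)
    -- the observer gain and the user-defined matrix of the error model
    (L : Matrix (Fin n) (Fin p) ℝ) (hL : IsSchur (A - L * C))
    (Aε : Matrix (Fin n) (Fin n) ℝ) (hAε : Aε.charpoly = (A - L * C).charpoly)
    -- the weights and the initial matrix
    (Qy : Matrix (Fin p) (Fin p) ℝ) (hQy : Qy.PosSemidef)
    (R : Matrix (Fin m) (Fin m) ℝ) (hR : R.PosDef)
    (Qε : Matrix (EtaIdx n m p) (EtaIdx n m p) ℝ) (hQε : Qε.PosDef)
    (P0 : Matrix (EtaIdx n m p) (EtaIdx n m p) ℝ) (hP0 : P0.PosSemidef)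
    -- the collected data
    (x : ℕ → Fin n → ℝ) (u : ℕ → Fin m → ℝ) (y : ℕ → Fin p → ℝ) (η : ℕ → EtaIdx n m p → ℝ)
    (hdata : IsTrajectory A B C L Aε x u y η)
    (hηε : IsUnit (adjCoeff Aε (η 0 ∘ Sum.inr)))
    -- the two rank conditions
    (kN : ℕ)
    (hrank : (dataPi kN η u).rank =
      (n * (m + p + 1) + m) * (n * (m + p + 1) + m + 1) / 2)
    (hM : (paramMatrix (A - L * C) Aε B L (x 0) (η 0)).rank = n) :
    (∃ S : VISequence n m p, IsVIRun Qε Qy R P0 kN η y u S) ∧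
      ∀ S : VISequence n m p, IsVIRun Qε Qy R P0 kN η y u S →
        ∃ j : ℕ, AsymptoticallyStable (closedLoop A B C L Aε (S.gain j)) := by
  have hAL : SchurStable (A - L * C) := hL
  set M := paramMatrix (A - L * C) Aε B L (x 0) (η 0) with hMdef
  have h1 : M * G1 m p (A - L * C) Aε = (A - L * C) * M := paramMatrix_mul_G1 hAε hηε
  have hMB : M * (G2 n m p * inputSel m p) = B := paramMatrix_mul_input
  have hML : M * (G2 n m p * outputSel m p) = L := paramMatrix_mul_output
  have hMx : ∀ k, M *ᵥ η k = x k :=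
    state_eq_mulVec hdata h1 hMB hML (paramMatrix_mulVec_init hηε)
  set F := reducedStateMatrix A C L Aε M with hF
  set G := G2 n m p * inputSel m p with hG
  have hη : ∀ k, η (k + 1) = F *ᵥ η k + G *ᵥ u k := internal_eq_reduced hdata hMx
  have hy : ∀ k, y k = (C * M) *ᵥ η k := fun k => by
    rw [hdata.output, ← hMx, mulVec_mulVec]
  have hinj : Function.Injective (dataPi kN η u).mulVec :=
    mulVec_injective_of_rank_eq_card (hrank.trans (card_thetaIdx n m p).symm)
  have hQεs : Qε.IsSymm := by simpa using hQε.isHermitian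
  have hQys : Qy.IsSymm := by simpa using hQy.isHermitian
  have hRs : R.IsSymm := by simpa using hR.isHermitian
  have hP0s : P0.IsSymm := by simpa using hP0.isHermitian
  set Q := Qε + (C * M)ᵀ * Qy * (C * M) with hQ
  have hQpos : Q.PosDef := posDef_add_transpose_mul_mul hQε hQy
  have hQs : Q.IsSymm := by simpa using hQpos.isHermitian
  constructor
  · let P : ℕ → Matrix (EtaIdx n m p) (EtaIdx n m p) ℝ := fun j => Nat.rec P0
      (fun _ X => Q + Fᵀ * X * F - Fᵀ * X * G * (R + Gᵀ * X * G)⁻¹ * (Fᵀ * X * G)ᵀ) j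
    have hPs : ∀ j, (P j).IsSymm := by
      intro j
      induction j with
      | zero => exact hP0s
      | succ j ih => exact isSymm_riccati hQs ih hRs
    refine ⟨⟨P, fun j => Q + Fᵀ * P j * F, fun j => Fᵀ * P j * G, fun j => R + Gᵀ * P j * G⟩, rfl,
      fun j => ?_, fun j => ?_, fun j => ?_, fun j => rfl⟩
    · simp only [IsSymm, transpose_add, transpose_mul, transpose_transpose, (hPs j).eq, hQs.eq,
        Matrix.mul_assoc]
    · simp only [IsSymm, transpose_add, transpose_mul, transpose_transpose, (hPs j).eq, hRs.eq,
        Matrix.mul_assoc]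
    · exact dataPi_mulVec_riccati hQεs hQys hRs (hPs j) hη hy
  · intro S hS
    have hlearn : ∀ j, (S.P j).IsSymm → S.Pηη j = Q + Fᵀ * S.P j * F ∧
        S.Pηu j = Fᵀ * S.P j * G ∧ S.Puu j = R + Gᵀ * S.P j * G := fun j hj =>
      eq_riccati_of_learning hQεs hQys hRs hj hη hy hinj (hS.symm_ηη j) (hS.symm_uu j)
        (hS.learning j)
    have hPs : ∀ j, (S.P j).IsSymm := by
      intro j
      induction j with
      | zero => rw [hS.init]; exact hP0s
      | succ j ih =>
        obtain ⟨e1, e2, e3⟩ := hlearn j ih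
        rw [hS.update, e1, e2, e3]
        exact isSymm_riccati hQs ih hRs
    have hstab := exists_schurStable_reduced hAB
      ((hAL.companionOf hAε hηε).fromBlocks_kronecker (hAL.of_charpoly_eq hAε)) h1 hMB hML
    obtain ⟨j, hj⟩ := exists_schurStable_of_valueIteration hQpos hR hstab (P := S.P)
      (by rw [hS.init]; exact hP0) fun j => by
        obtain ⟨e1, e2, e3⟩ := hlearn j (hPs j)
        rw [hS.update, e1, e2, e3]
    refine ⟨j, asymptoticallyStable_closedLoop hAL h1 hMB hML ?_⟩
    obtain ⟨-, e2, e3⟩ := hlearn j (hPs j)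
    rw [VISequence.gain, e2, e3]
    exact hj
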